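/- Notation. For a nonzero integer $n$, $\tau(n)$ is the number of positive divisors of $n$. A positive integer $n$ is $s$-simple ($s$ real) if $\tau(n)\le s$. A probability distribution $D$ carried by a finite set $S$ is $(C,N)$-uniform on $S$ if $D(T)\le C|T|/|S|$ for every set $T$ of at most $N$ points. Setting. Let $0<k<d$ be integers with $\gcd(k,d)=1$, let $m\ge 1$, $L\ge 0$, $H\ge 1$ be integers and $C$ a real number. Let $a_0$ be an integer-valued random variable and $t_1,\dots,t_m$ real-valued random variables such that $a_0,t_1,\dots,t_m$ are mutually independent, and such that for each $i$ the distribution of $t_i$ is $(C,2^dL)$-uniform on some finite set $H_i\subset\mathbb R$ with $|H_i|\ge H$. Let $a_1,\dots,a_{d-1}$ be integer-valued random variables such that almost surely $$a_k=F_2(a_0,t_1,\dots,t_m),\qquad (a_j)_{1\le j\le d-1,\ j\ne k}=F_1(a_0,t_1,\dots,t_{m-1}),$$ where $F_2:\mathbb R^{m+1}\to\mathbb R$ and $F_1:\mathbb R^m\to\mathbb R^{d-2}$ are polynomial maps (with real coefficients) of total degree at most $L$, and for every nonzero integer $c$ that $a_0$ takes with positive probability the polynomial $F_2(c,t_1,\dots,t_m)$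 has positive degree in $t_m$. Let $f(x)=x^d+a_{d-1}x^{d-1}+\dots+a_1x+a_0$. Theorem. Then $$\mathbb P(f\text{ is irreducible over }\mathbb Z)\ \ge\ 1-\mathbb P(a_0=0)-\frac{2Cdm2^dL\;\mathbb E[\tau(a_0)\mathbf 1_{a_0\ne0}]}{H}$$ (if the expectation is infinite, the bound says nothing when $L\ge1$; here $0\cdot\infty=0$). In particular: (1) For every nonzero $P\in\mathbb Z[x]$ there is a constant $C(P)$, depending only on $P$, such that in the above setting, if $H\ge 3$ and $a_0$ is uniformly distributed on the set $\{P(n): -H\le n\le H\}$ of values of $P$ at integers, or is distributed as $P(n)$ with $n$ uniform in $\{-H,\dots,H\}$, then $$\mathbb P(f\text{ is irreducible over }\mathbb Z)\ \ge\ 1-\frac{\deg P}{2H+1}-\frac{2Cmd2^dL(\log H)^{C(P)}}{H}.$$ (2) If almost surely $a_0\neq 0$ and $|a_0|$ is $s$-simple, then $$\mathbb P(f\text{ is irreducible over }\mathbb Z)\ \ge\ 1-\frac{2Cmd2^dLs}{H}.$$ -/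

import Mathlib

open MeasureTheory ProbabilityTheory
open scoped ENNReal Polynomial

universe u

noncomputable section

namespace RandomPoly

/-- The number of positive divisors of a nonzero integer. (At `0` this returns `0`; it is only used
at nonzero integers below.) -/
def tau (n : ℤ) : ℕ := n.natAbs.divisors.card

/-- A positive integer `n` is `s`-simple if it has at most `s` positive divisors. -/
def IsSimple (s : ℝ) (n : ℕ) : Prop := 0 < n ∧ (tau n : ℝ) ≤ s

/-- The distribution `D`, carried by the finite set `S`, is `(C, N)`-uniform on `S`: every set `T`
of at most `N` points satisfies `D(T) ≤ C |T| / |S|`. -/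
def IsUniform {E : Type*} [MeasurableSpace E] (C : ℝ) (N : ℕ) (S : Finset E) (D : Measure E) :
    Prop :=
  D (S : Set E)ᶜ = 0 ∧
    ∀ T : Finset E, T.card ≤ N → D.real (T : Set E) ≤ C * T.card / S.card

/-- The monic polynomial `x ^ d + a_{d-1} x ^ (d-1) + ⋯ + a_1 x + a_0`. -/
def monicPoly (d : ℕ) (a : ℕ → ℤ) : ℤ[X] :=
  Polynomial.X ^ d + ∑ j ∈ Finset.range d, Polynomial.C (a j) * Polynomial.X ^ j

/-- The vector `(a₀, t₁, …, t_m)`, indexed by `0, …, m`. -/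
def inputs {m : ℕ} (a₀ : ℤ) (t : Fin m → ℝ) : Fin (m + 1) → ℝ := Fin.cons (a₀ : ℝ) t

/-- The polynomial `F(c, t₁, …, t_m)` obtained by fixing the value `c` of the variable of
index `0`. -/
def fixFirst {m : ℕ} (c : ℝ) (F : MvPolynomial (Fin (m + 1)) ℝ) : MvPolynomial (Fin (m + 1)) ℝ :=
  MvPolynomial.bind₁ (fun i => if i = 0 then MvPolynomial.C c else MvPolynomial.X i) F

variable {Ω : Type u} [MeasurableSpace Ω]

/-- The random coefficient model. The coefficients are `a 0, …, a (d - 1)` (the values `a j` with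
`d ≤ j` play no role) and the polynomials `F₁ j` give the coefficients `a j` with
`1 ≤ j ≤ d - 1`, `j ≠ k` (the other `F₁ j` play no role). `F₁ j` is a polynomial in
`a₀, t₁, …, t_{m-1}` and `F₂` is a polynomial in `a₀, t₁, …, t_m`. The distribution of `a 0`
is arbitrary. -/
structure Model (d k m L H : ℕ) (C : ℝ) (μ : Measure Ω) (a : ℕ → Ω → ℤ) (t : Fin m → Ω → ℝ)
    (F₁ : ℕ → MvPolynomial (Fin m) ℝ) (F₂ : MvPolynomial (Fin (m + 1)) ℝ)
    (S : Fin m → Finset ℝ) : Prop where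
  k_pos : 0 < k
  k_lt : k < d
  k_coprime : Nat.Coprime k d
  m_pos : 0 < m
  measurable_a : Measurable (a 0)
  measurable_t : ∀ i, Measurable (t i)
  /-- `a₀, t₁, …, t_m` are mutually independent -/
  indep : iIndepFun (fun (i : Fin (m + 1)) ω => inputs (a 0 ω) (fun l => t l ω) i) μ
  deg₁ : ∀ j, 1 ≤ j → j < d → j ≠ k → (F₁ j).totalDegree ≤ L
  deg₂ : F₂.totalDegree ≤ L
  /-- `a_j = F₁ⱼ(a₀, t₁, …, t_{m-1})` -/
  eq₁ : ∀ j, 1 ≤ j → j < d → j ≠ k → ∀ᵐ ω ∂μ, (a j ω : ℝ) =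
    MvPolynomial.eval (fun i : Fin m => inputs (a 0 ω) (fun l => t l ω) i.castSucc) (F₁ j)
  /-- `a_k = F₂(a₀, t₁, …, t_m)` -/
  eq₂ : ∀ᵐ ω ∂μ, (a k ω : ℝ) = MvPolynomial.eval (inputs (a 0 ω) (fun l => t l ω)) F₂
  /-- `F₂` has positive degree in `t_m` for each fixed nonzero value of `a₀` -/
  nondeg : ∀ c : ℤ, c ≠ 0 → μ {ω | a 0 ω = c} ≠ 0 →
    0 < (fixFirst (c : ℝ) F₂).degreeOf (Fin.last m)
  card_le : ∀ i, H ≤ (S i).card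
  uniform : ∀ i, IsUniform C (2 ^ d * L) (S i) (μ.map (t i))

/-- The event that the random polynomial is irreducible over `ℤ`. -/
def irredEvent (d : ℕ) (a : ℕ → Ω → ℤ) : Set Ω :=
  {ω | Irreducible (monicPoly d (fun j => a j ω))}

/-- `X` is uniformly distributed on the set of values `{P(n) : -H ≤ n ≤ H}`. -/
def UniformOnValueSet (μ : Measure Ω) (X : Ω → ℤ) (P : ℤ[X]) (H : ℕ) : Prop :=
  ∀ v ∈ (Finset.Icc (-(H : ℤ)) H).image (fun n => P.eval n),
    μ.real {ω | X ω = v} = 1 / ((Finset.Icc (-(H : ℤ)) H).image (fun n => P.eval n)).card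

/-- `X` has the distribution of `P(n)` with `n` uniformly distributed in `{-H, …, H}`, that is,
the values `P(n)` are counted with multiplicity. -/
def UniformOnValueList (μ : Measure Ω) (X : Ω → ℤ) (P : ℤ[X]) (H : ℕ) : Prop :=
  ∀ v : ℤ, μ.real {ω | X ω = v} =
    ((Finset.Icc (-(H : ℤ)) H).filter (fun n => P.eval n = v)).card / (2 * H + 1)

end RandomPoly

end

/-! Condition on `a₀ = c ≠ 0`. A reducible monic `f` has a monic factor of some degree `0 < e < d`
whose constant term `u` divides `c`, so at most `2 (d - 1) τ(c)` pairs `(e, u)` arise. Fix one pair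
and all coefficients but the `k`-th, and let that one be `T`. Up to sign `u` is a product of `e`
roots of `f₀ + T X ^ k`, so `T` is a zero of `R(T) = ∏ ((-1) ^ e u - s.prod)`, over the
sub-multisets `s` of `e` roots. Being symmetric in the roots, `R` is a polynomial in `T`; its degree
is at most `choose d e ≤ 2 ^ d`, since every product of roots is `O(|T|)` for `|T| ≥ 1` by Mahler
measure. It is nonzero: for large `T` the roots have size about `|T| ^ (1 / (d - k))` or `|T| ^ (-1
/ k)`, so a product of `e` of them has size about `|T| ^ ((e k - i d) / (k (d - k)))` with `i` an
integer, and `e k ≠ i d` because `k` and `d` are coprime (`exists_finset_factor`).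

The coefficients other than `a_k` do not involve `t_m`. Once `t₁, …, t_{m-1}` are fixed, `a_k` is a
polynomial in `t_m` of degree at most `L`. It is nonconstant unless a leading coefficient vanishes,
an event controlled by Schwartz-Zippel (`pi_eval_eq_zero_le`). Each pair `(e, u)` then excludes at
most `2 ^ d L` values of `t_m`. With `ε = C 2 ^ d L / H` the conditional probability of reducibility
is at most `(m - 1 + 2 (d - 1) τ(c)) ε ≤ 2 d m τ(c) ε`, and one sums over `c`.

For constant terms `P(n)` it remains to bound the mean of `τ(P(n))` by a power of `log H`. After
passing to a monic `Q`, `τ(Q(n))` is dominated by a power of `τ(q)` for a divisor `q` no larger than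
the range of `n` (`exists_small_divisor`). The solutions of `Q ≡ 0 (mod q)` fill few classes modulo
`ceilRoot D q`, `D = deg Q`, and grouping the `q` by `ceilRoot` leaves the moments `∑ τ(s) ^ B / s`.
-/

namespace RandomPoly

/-! ### Factors with given degree and constant term in the family `f + T X ^ k`. -/

section FactorCount
open Polynomial Filter Topology

/-- The product of `u - s.prod` over the sub-multisets `s` of size `e` of a multiset of size `d`
is a polynomial in its elementary symmetric functions. -/
lemma exists_aeval_esymm_eq_prod_powersetCard (d e : ℕ) (u : ℂ) :
    ∃ Ψ : MvPolynomial (Fin d) ℂ, ∀ S : Multiset ℂ, S.card = d →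
      MvPolynomial.aeval (fun i : Fin d => S.esymm (i + 1)) Ψ =
        ((S.powersetCard e).map (fun T => u - T.prod)).prod := by
  let p : MvPolynomial (Fin d) ℂ := ∏ I ∈ (Finset.univ : Finset (Fin d)).powersetCard e,
    (MvPolynomial.C u - ∏ i ∈ I, MvPolynomial.X i)
  have hp : p.IsSymmetric := by
    intro σ
    simp only [p, map_prod, map_sub, MvPolynomial.rename_C, MvPolynomial.rename_X]
    refine Finset.prod_bij (fun I _ => I.map σ.toEmbedding) ?_ ?_ ?_ ?_
    · intro I hI
      simpa [Finset.mem_powersetCard] using hI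
    · intro I _ J _ h
      exact Finset.map_injective _ h
    · intro J hJ
      refine ⟨J.map σ.symm.toEmbedding, ?_, ?_⟩
      · simpa [Finset.mem_powersetCard] using hJ
      · ext x; simp
    · intro I _
      simp [Finset.prod_map]
  -- Fundamental theorem of symmetric polynomials, applied to `p`.
  obtain ⟨Ψ, hΨ⟩ := MvPolynomial.esymmAlgHom_surjective (σ := Fin d) (R := ℂ) (n := d)
    (by simp) ⟨p, hp⟩
  refine ⟨Ψ, fun S hS => ?_⟩
  have hΨ' := MvPolynomial.esymmAlgHom_apply (σ := Fin d) (R := ℂ) (n := d) Ψ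
  rw [hΨ] at hΨ'
  obtain ⟨z, rfl⟩ : ∃ z : Fin d → ℂ, (Finset.univ.val.map z : Multiset ℂ) = S := by
    obtain ⟨l, rfl⟩ := Quot.exists_rep S
    replace hS : l.length = d := hS
    subst hS
    exact ⟨l.get, by rw [Fin.univ_val_map, List.ofFn_get]; rfl⟩
  have h := congrArg (MvPolynomial.aeval z) hΨ'
  rw [← AlgHom.comp_apply, MvPolynomial.comp_aeval] at h
  simp only [MvPolynomial.aeval_esymm_eq_multiset_esymm] at h
  rw [← h]
  simp only [p, map_prod, map_sub, MvPolynomial.aeval_X, MvPolynomial.aeval_C,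
    Multiset.powersetCard_map, ← Finset.map_val_val_powersetCard, Multiset.map_map]
  rfl

/-- Induction on `n`: removing the constant term and dividing by `X` lowers both the degree and the
growth exponent by one. -/
lemma natDegree_le_of_norm_eval_le (n : ℕ) : ∀ (R : ℂ[X]) (B : ℝ),
    (∀ T : ℂ, 1 ≤ ‖T‖ → ‖R.eval T‖ ≤ B * ‖T‖ ^ n) → R.natDegree ≤ n := by
  induction n with
  | zero =>
    intro R B h
    by_contra! hc
    have h1 := R.tendsto_norm_atTop (natDegree_pos_iff_degree_pos.mp hc)
      (l := atTop) (z := fun x : ℕ => (x : ℂ))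
      (by simpa using tendsto_natCast_atTop_atTop (R := ℝ))
    obtain ⟨N, hN1, hN2⟩ := ((h1.eventually_gt_atTop B).and (eventually_ge_atTop 1)).exists
    have := h N (by simpa using hN2)
    simp only [pow_zero, mul_one] at this
    linarith
  | succ n ih =>
    intro R B h
    have := ih R.divX (B + ‖R.coeff 0‖) (fun T hT => by
      have h0 : R.eval T = R.divX.eval T * T + R.coeff 0 := by
        conv_lhs => rw [← R.divX_mul_X_add]
        simp
      have hT0 : 0 < ‖T‖ := by linarith
      have h1 := h T hT
      have h2 : ‖R.divX.eval T‖ * ‖T‖ ≤ ‖R.eval T‖ + ‖R.coeff 0‖ := by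
        rw [← norm_mul]
        calc _ = ‖R.eval T - R.coeff 0‖ := by rw [h0]; ring_nf
          _ ≤ _ := norm_sub_le _ _
      have h3 : 1 ≤ ‖T‖ ^ (n + 1) := one_le_pow₀ hT
      have h4 : ‖R.coeff 0‖ ≤ ‖R.coeff 0‖ * ‖T‖ ^ (n + 1) :=
        le_mul_of_one_le_right (norm_nonneg _) h3
      refine le_of_mul_le_mul_right ?_ hT0
      calc _ ≤ _ := h2
        _ ≤ B * ‖T‖ ^ (n + 1) + ‖R.coeff 0‖ * ‖T‖ ^ (n + 1) := by linarith
        _ = _ := by ring)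
    rw [natDegree_divX_eq_natDegree_tsub_one] at this
    omega

/-- The product of any of the roots of a monic polynomial is at most the Mahler measure. -/
lemma norm_prod_le_sum_norm_coeff {f : ℂ[X]} (hf : f.Monic) {T : Multiset ℂ}
    (hT : T ≤ f.roots) : ‖T.prod‖ ≤ ∑ i ∈ Finset.range (f.natDegree + 1), ‖f.coeff i‖ := by
  have h1 := f.mahlerMeasure_le_sum_norm_coeff
  rw [mahlerMeasure_eq_leadingCoeff_mul_prod_roots, hf.leadingCoeff, norm_one, one_mul,
    Polynomial.sum_over_range _ (by simp)] at h1
  refine le_trans ?_ h1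
  obtain ⟨U, hU⟩ := Multiset.le_iff_exists_add.mp hT
  have h2 : ∀ V : Multiset ℂ, 1 ≤ (V.map (fun a => max 1 ‖a‖)).prod := fun V => by
    refine Multiset.one_le_prod fun x hx => ?_
    obtain ⟨a, -, rfl⟩ := Multiset.mem_map.mp hx
    exact le_max_left _ _
  have h3 : ∀ V : Multiset ℂ, ‖V.prod‖ ≤ (V.map (fun a => max 1 ‖a‖)).prod := fun V => by
    induction V using Multiset.induction_on with
    | empty => simp
    | cons a V ih =>
      simp only [Multiset.prod_cons, norm_mul, Multiset.map_cons]
      exact mul_le_mul (le_max_right _ _) ih (norm_nonneg _) (by positivity)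
  rw [hU, Multiset.map_add, Multiset.prod_add]
  exact (h3 T).trans (le_mul_of_one_le_right ((norm_nonneg _).trans (h3 T)) (h2 U))

/-- Applied to `f` for the small roots and, through `α⁻¹`, to `f.reverse` for the large ones. -/
lemma exists_norm_eval_bounds_near_zero {p : ℂ[X]} (hp : p.coeff 0 ≠ 0) :
    ∃ ρ : ℝ, 0 < ρ ∧ ∀ α : ℂ, ‖α‖ ≤ ρ →
      ‖p.coeff 0‖ / 2 ≤ ‖p.eval α‖ ∧ ‖p.eval α‖ ≤ 2 * ‖p.coeff 0‖ := by
  have hc : 0 < ‖p.coeff 0‖ := norm_pos_iff.mpr hp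
  have h := (p.continuous.norm.tendsto 0)
  rw [← coeff_zero_eq_eval_zero] at h
  have h1 := (h.eventually_const_le (show ‖p.coeff 0‖ / 2 < ‖p.coeff 0‖ by linarith)).and
    (h.eventually_le_const (show ‖p.coeff 0‖ < 2 * ‖p.coeff 0‖ by linarith))
  obtain ⟨ρ, hρ, h2⟩ := Metric.nhds_basis_closedBall.eventually_iff.mp h1
  exact ⟨ρ, hρ, fun α hα => h2 (by simpa using hα)⟩

/-- For large `T` every root `α` of `f + T X ^ k` satisfies `|α| ^ (d - k) ≍ |T|` or
`|α| ^ k ≍ |T|⁻¹`. -/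
lemma exists_log_norm_root_bounds {d k : ℕ} (hk : 0 < k) (hkd : k < d) {f : ℂ[X]}
    (hf : f.Monic) (hd : f.natDegree = d) (h0 : f.coeff 0 ≠ 0) :
    ∃ M T₀ : ℝ, ∀ T : ℂ, T₀ < ‖T‖ → ∀ α : ℂ, (f + C T * X ^ k).eval α = 0 → α ≠ 0 ∧
      (|(k * (d - k) : ℝ) * Real.log ‖α‖ - k * Real.log ‖T‖| ≤ M ∨
        |(k * (d - k) : ℝ) * Real.log ‖α‖ - (k - d : ℝ) * Real.log ‖T‖| ≤ M) := by
  obtain ⟨ρ, hρ, hsmall⟩ := exists_norm_eval_bounds_near_zero h0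
  have hr0 : f.reverse.coeff 0 = 1 := by rw [coeff_zero_reverse, hf.leadingCoeff]
  obtain ⟨ρ', hρ', hlarge⟩ := exists_norm_eval_bounds_near_zero (p := f.reverse) (by simp [hr0])
  obtain ⟨B, hB⟩ := (isCompact_closedBall (0 : ℂ) ρ'⁻¹).exists_bound_of_continuousOn
    f.continuous.continuousOn
  have hc : 0 < ‖f.coeff 0‖ := norm_pos_iff.mpr h0
  have hkd' : (k : ℝ) < d := by exact_mod_cast hkd
  have hk' : (0 : ℝ) < k := by exact_mod_cast hk
  have hl2 : 0 < Real.log 2 := Real.log_pos (by norm_num)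
  -- A root satisfies `|f(α)| = |T| |α| ^ k`. For small `α` the left side is comparable to `|f(0)|`,
  -- for large `α` to `|α| ^ d`; taking logarithms and multiplying by `d - k` or `-k` gives the two
  -- alternatives. The threshold `B / ρ ^ k` excludes roots in the annulus between, where `|f| ≤ B`.
  refine ⟨d * (Real.log 2 + |Real.log ‖f.coeff 0‖|), max 0 (B / ρ ^ k), fun T hT α hα => ?_⟩
  have hT0 : 0 < ‖T‖ := (le_max_left _ _).trans_lt hT
  have hα' : ‖f.eval α‖ = ‖T‖ * ‖α‖ ^ k := by
    rw [← norm_pow, ← norm_mul, ← norm_neg (T * α ^ k)]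
    congr 1
    simp only [eval_add, eval_mul, eval_C, eval_pow, eval_X] at hα
    linear_combination hα
  have hα0 : α ≠ 0 := by
    rintro rfl
    simp [hk.ne', ← coeff_zero_eq_eval_zero, h0] at hα'
  have ha : 0 < ‖α‖ := norm_pos_iff.mpr hα0
  have hlog : Real.log (‖T‖ * ‖α‖ ^ k) = Real.log ‖T‖ + k * Real.log ‖α‖ := by
    rw [Real.log_mul hT0.ne' (by positivity), Real.log_pow]
  refine ⟨hα0, ?_⟩
  by_cases hle : ‖α‖ ≤ ρ
  · right
    obtain ⟨h1, h2⟩ := hsmall α hle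
    rw [hα'] at h1 h2
    have h3 := Real.log_le_log (by positivity) h1
    have h4 := Real.log_le_log (by positivity) h2
    rw [hlog, Real.log_div hc.ne' (by norm_num)] at h3
    rw [hlog, Real.log_mul (by norm_num) hc.ne'] at h4
    have h5 : |Real.log ‖T‖ + k * Real.log ‖α‖| ≤ Real.log 2 + |Real.log ‖f.coeff 0‖| := by
      rw [abs_le]
      constructor
      · linarith [neg_abs_le (Real.log ‖f.coeff 0‖)]
      · linarith [le_abs_self (Real.log ‖f.coeff 0‖)]
    calc _ = |(d - k : ℝ) * (Real.log ‖T‖ + k * Real.log ‖α‖)| := by congr 1; ring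
      _ = (d - k : ℝ) * |Real.log ‖T‖ + k * Real.log ‖α‖| := by
        rw [abs_mul, abs_of_pos (by linarith)]
      _ ≤ _ := mul_le_mul (by linarith) h5 (abs_nonneg _) (by positivity)
  · by_cases hge : ρ'⁻¹ ≤ ‖α‖
    · left
      have h1 := hlarge α⁻¹ (by rw [norm_inv]; exact inv_le_of_inv_le₀ hρ' hge)
      rw [hr0, norm_one] at h1
      have h2 : f.eval α = f.reverse.eval α⁻¹ * α ^ d := by
        let := invertibleOfNonzero hα0
        have hu := eval₂_reverse_mul_pow (RingHom.id ℂ) α f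
        simp only [invOf_eq_inv, hd] at hu
        exact hu.symm
      have h3 : ‖f.reverse.eval α⁻¹‖ = ‖T‖ * ‖α‖ ^ k / ‖α‖ ^ d := by
        rw [← hα', h2, norm_mul, norm_pow]; field_simp
      rw [h3] at h1
      have h4 := Real.log_le_log (by norm_num) h1.1
      have h5 := Real.log_le_log (by positivity) h1.2
      rw [Real.log_div (by positivity) (by positivity), hlog, Real.log_pow] at h5
      rw [one_div, Real.log_inv, Real.log_div (by positivity) (by positivity), hlog,
        Real.log_pow] at h4
      rw [mul_one] at h5
      have h6 : |Real.log ‖T‖ + k * Real.log ‖α‖ - d * Real.log ‖α‖| ≤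
          Real.log 2 + |Real.log ‖f.coeff 0‖| := by
        rw [abs_le]
        constructor <;> linarith [abs_nonneg (Real.log ‖f.coeff 0‖)]
      calc _ = |(-k : ℝ) * (Real.log ‖T‖ + k * Real.log ‖α‖ - d * Real.log ‖α‖)| := by
            congr 1; ring
        _ = k * |Real.log ‖T‖ + k * Real.log ‖α‖ - d * Real.log ‖α‖| := by
          rw [abs_mul, abs_neg, abs_of_pos hk']
        _ ≤ _ := mul_le_mul hkd'.le h6 (abs_nonneg _) (by positivity)
    · exfalso
      push Not at hle hge
      have h1 := hB α (by simpa using hge.le)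
      rw [hα'] at h1
      have h2 : B < ‖T‖ * ρ ^ k := by
        rw [← div_lt_iff₀ (by positivity)]
        exact (le_max_right _ _).trans_lt hT
      have h3 : ‖T‖ * ρ ^ k ≤ ‖T‖ * ‖α‖ ^ k := by gcongr
      linarith

/-- `i` counts the factors of the small kind: each contributes `k - d` where a large one contributes
`k`. -/
lemma exists_log_norm_prod_bound {d k : ℕ} {T : ℂ} {M : ℝ} (s : Multiset ℂ)
    (hs : ∀ α ∈ s, α ≠ 0 ∧
      (|(k * (d - k) : ℝ) * Real.log ‖α‖ - k * Real.log ‖T‖| ≤ M ∨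
        |(k * (d - k) : ℝ) * Real.log ‖α‖ - (k - d : ℝ) * Real.log ‖T‖| ≤ M)) :
    ∃ i : ℕ, |(k * (d - k) : ℝ) * Real.log ‖s.prod‖ - (s.card * k - i * d : ℝ) * Real.log ‖T‖|
      ≤ s.card * M := by
  induction s using Multiset.induction_on with
  | empty => exact ⟨0, by simp⟩
  | cons α s ih =>
    obtain ⟨i, hi⟩ := ih fun β hβ => hs β (Multiset.mem_cons_of_mem hβ)
    obtain ⟨h0, h1⟩ := hs α (Multiset.mem_cons_self α s)
    have hp : s.prod ≠ 0 := by
      rw [Ne, Multiset.prod_eq_zero_iff]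
      exact fun h => (hs 0 (Multiset.mem_cons_of_mem h)).1 rfl
    have hl : Real.log ‖(α ::ₘ s).prod‖ = Real.log ‖α‖ + Real.log ‖s.prod‖ := by
      rw [Multiset.prod_cons, norm_mul,
        Real.log_mul (norm_ne_zero_iff.mpr h0) (norm_ne_zero_iff.mpr hp)]
    rw [hl, Multiset.card_cons]
    push_cast
    rcases h1 with h1 | h1
    · refine ⟨i, ?_⟩
      have := (abs_add_le _ _).trans (add_le_add h1 hi)
      calc _ = _ := by congr 1; ring
        _ ≤ _ := this
        _ = _ := by ring
    · refine ⟨i + 1, ?_⟩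
      have := (abs_add_le _ _).trans (add_le_add h1 hi)
      calc _ = _ := by congr 1; push_cast; ring
        _ ≤ _ := this
        _ = _ := by ring

lemma exists_prod_roots_ne {d k e : ℕ} (hk : 0 < k) (hkd : k < d) (hcop : Nat.Coprime k d)
    (he : 0 < e) (hed : e < d) {f : ℂ[X]} (hf : f.Monic) (hd : f.natDegree = d)
    (h0 : f.coeff 0 ≠ 0) (r : ℝ) :
    ∃ T : ℂ, ∀ s : Multiset ℂ, s ≤ (f + C T * X ^ k).roots → s.card = e → ‖s.prod‖ ≠ r := by
  obtain ⟨M, T₀, h⟩ := exists_log_norm_root_bounds hk hkd hf hd h0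
  obtain ⟨x, hx1, hx2⟩ := ((eventually_gt_atTop (max T₀ 1)).and
    (Real.tendsto_log_atTop.eventually_gt_atTop
      (e * M + |(k * (d - k) : ℝ) * Real.log r|))).exists
  have hx0 : 1 < x := (le_max_right _ _).trans_lt hx1
  have hn : ‖(x : ℂ)‖ = x := by simp [abs_of_pos (show 0 < x by linarith)]
  refine ⟨x, fun s hs hse hr => ?_⟩
  obtain ⟨i, hi⟩ := exists_log_norm_prod_bound (d := d) (k := k) (T := x) (M := M) s fun α hα =>
    h x (by rw [hn]; exact (le_max_left _ _).trans_lt hx1) α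
      (isRoot_of_mem_roots (Multiset.mem_of_le hs hα))
  rw [hn, hr, hse] at hi
  -- If `e k = i d`, coprimality gives `d ∣ e`, against `0 < e < d`. So `log |s.prod|` has a nonzero
  -- multiple of `log x` as main term and cannot stay equal to `log r`.
  have hN : (e * k - i * d : ℤ) ≠ 0 := by
    intro hN
    have : d ∣ e * k := ⟨i, by zify; linarith⟩
    exact absurd (Nat.le_of_dvd he (hcop.symm.dvd_of_dvd_mul_right this)) (by omega)
  have hN1 : (1 : ℝ) ≤ |(e * k - i * d : ℝ)| := by
    exact_mod_cast Int.one_le_abs hN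
  have hlx : 0 < Real.log x := Real.log_pos hx0
  have h1 : Real.log x ≤ |(e * k - i * d : ℝ) * Real.log x| := by
    rw [abs_mul, abs_of_pos hlx]
    exact le_mul_of_one_le_left hlx.le hN1
  have h2 := abs_sub_abs_le_abs_sub ((e * k - i * d : ℝ) * Real.log x)
    ((k * (d - k) : ℝ) * Real.log r)
  rw [abs_sub_comm] at h2
  linarith

/-- For fixed `f`, there are at most `2 ^ d` values of `T` for which `f + T X ^ k` has a
monic factor of degree `e` with constant term `u`. -/
lemma exists_finset_factor {d k e : ℕ} (hk : 0 < k) (hkd : k < d)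
    (hcop : Nat.Coprime k d) (he : 0 < e) (hed : e < d) {f : ℂ[X]} (hf : f.Monic)
    (hd : f.natDegree = d) (h0 : f.coeff 0 ≠ 0) (u : ℂ) :
    ∃ 𝒯 : Finset ℂ, 𝒯.card ≤ 2 ^ d ∧ ∀ T : ℂ, ∀ g : ℂ[X], g.Monic → g.natDegree = e →
      g.coeff 0 = u → g ∣ f + C T * X ^ k → T ∈ 𝒯 := by
  obtain ⟨Ψ, hΨ⟩ := exists_aeval_esymm_eq_prod_powersetCard d e ((-1) ^ e * u)
  have hdeg : ∀ T : ℂ, (C T * X ^ k).degree < f.degree := fun T => by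
    refine (degree_C_mul_X_pow_le k T).trans_lt ?_
    rw [degree_eq_natDegree hf.ne_zero, hd]
    exact_mod_cast hkd
  have hmon : ∀ T : ℂ, (f + C T * X ^ k).Monic := fun T => hf.add_of_left (hdeg T)
  have hnat : ∀ T : ℂ, (f + C T * X ^ k).natDegree = d := fun T => by
    rw [← hd]; exact natDegree_eq_of_degree_eq (degree_add_eq_left_of_degree_lt (hdeg T))
  have hcard : ∀ T : ℂ, (f + C T * X ^ k).roots.card = d := fun T => by
    rw [splits_iff_card_roots.mp (IsAlgClosed.splits _), hnat]
  -- The elementary symmetric functions of the roots of `f + T X ^ k` are its coefficients up to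
  -- sign, hence affine in `T`; substituting them in `Ψ` makes the product over sub-multisets a
  -- polynomial in `T`.
  let R : ℂ[X] := MvPolynomial.aeval (fun i : Fin d =>
    C ((-1) ^ ((i : ℕ) + 1) * f.coeff (d - (i + 1))) +
      C (if d - (i + 1) = k then (-1) ^ ((i : ℕ) + 1) else 0) * X) Ψ
  have hR : ∀ T : ℂ, R.eval T = (((f + C T * X ^ k).roots.powersetCard e).map
      (fun s : Multiset ℂ => (-1) ^ e * u - s.prod)).prod := fun T => by
    rw [← hΨ _ (hcard T)]
    simp only [R]
    rw [← coe_aeval_eq_eval, ← AlgHom.comp_apply, MvPolynomial.comp_aeval]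
    congr 2
    funext i
    have h1 := coeff_eq_esymm_roots_of_splits (IsAlgClosed.splits (f + C T * X ^ k))
      (k := d - (i + 1)) (by rw [hnat]; omega)
    rw [(hmon T).leadingCoeff, hnat, show d - (d - ((i : ℕ) + 1)) = i + 1 by omega, one_mul,
      coeff_add, coeff_C_mul_X_pow] at h1
    have h2 : ((-1 : ℂ) ^ ((i : ℕ) + 1)) * (-1) ^ ((i : ℕ) + 1) = 1 := by
      rw [← mul_pow]; simp
    calc _ = (-1) ^ ((i : ℕ) + 1) * (f.coeff (d - (i + 1)) +
          if d - ((i : ℕ) + 1) = k then T else 0) := by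
          simp only [coe_aeval_eq_eval, eval_add, eval_mul, eval_C, eval_X]
          split_ifs <;> ring
      _ = _ := by rw [h1, ← mul_assoc, h2, one_mul]
  have hR0 : R ≠ 0 := by
    intro hR0
    obtain ⟨T, hT⟩ := exists_prod_roots_ne hk hkd hcop he hed hf hd h0 ‖u‖
    have h1 := hR T
    rw [hR0, eval_zero, eq_comm, Multiset.prod_eq_zero_iff, Multiset.mem_map] at h1
    obtain ⟨s, hs, hs'⟩ := h1
    rw [Multiset.mem_powersetCard] at hs
    refine hT s hs.1 hs.2 ?_
    rw [← sub_eq_zero.mp hs']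
    simp
  have hRdeg : R.natDegree ≤ d.choose e := by
    refine natDegree_le_of_norm_eval_le _ R
      ((‖u‖ + (∑ i ∈ Finset.range (d + 1), ‖f.coeff i‖ + 1)) ^ d.choose e) fun T hT => ?_
    rw [hR, ← mul_pow]
    set Q := (f + C T * X ^ k).roots.powersetCard e with hQ
    have hQc : Q.card = d.choose e := by rw [hQ, Multiset.card_powersetCard, hcard]
    have hb : ∀ s ∈ Q, ‖(-1) ^ e * u - s.prod‖ ≤
        (‖u‖ + (∑ i ∈ Finset.range (d + 1), ‖f.coeff i‖ + 1)) * ‖T‖ := fun s hs => by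
      have h1 := norm_prod_le_sum_norm_coeff (hmon T) (Multiset.mem_powersetCard.mp hs).1
      rw [hnat] at h1
      have h2 : ∑ i ∈ Finset.range (d + 1), ‖(f + C T * X ^ k).coeff i‖ ≤
          ∑ i ∈ Finset.range (d + 1), ‖f.coeff i‖ + ‖T‖ := by
        calc _ ≤ ∑ i ∈ Finset.range (d + 1), (‖f.coeff i‖ + if i = k then ‖T‖ else 0) := by
              refine Finset.sum_le_sum fun i _ => ?_
              rw [coeff_add, coeff_C_mul_X_pow]
              refine (norm_add_le _ _).trans ?_
              split_ifs <;> simp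
          _ ≤ _ := by
            rw [Finset.sum_add_distrib, Finset.sum_ite_eq']
            split_ifs <;> simp
      have h3 : 0 ≤ ∑ i ∈ Finset.range (d + 1), ‖f.coeff i‖ :=
        Finset.sum_nonneg fun _ _ => norm_nonneg _
      calc _ ≤ ‖(-1) ^ e * u‖ + ‖s.prod‖ := norm_sub_le _ _
        _ ≤ ‖u‖ + (∑ i ∈ Finset.range (d + 1), ‖f.coeff i‖ + ‖T‖) := by
          have : ‖(-1) ^ e * u‖ = ‖u‖ := by simp
          linarith
        _ ≤ _ := by nlinarith [norm_nonneg u]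
    rw [← hQc]
    clear_value Q
    clear hQc hQ
    induction Q using Multiset.induction_on with
    | empty => simp
    | cons s Q ih =>
      simp only [Multiset.map_cons, Multiset.prod_cons, norm_mul, Multiset.card_cons, pow_succ']
      have h1 := hb s (Multiset.mem_cons_self s Q)
      exact mul_le_mul h1 (ih fun t ht => hb t (Multiset.mem_cons_of_mem ht)) (norm_nonneg _)
        ((norm_nonneg _).trans h1)
  refine ⟨R.roots.toFinset, ?_, fun T g hg hge hgu hdvd => ?_⟩
  · calc _ ≤ R.roots.card := Multiset.toFinset_card_le _
      _ ≤ R.natDegree := card_roots' R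
      _ ≤ d.choose e := hRdeg
      _ ≤ 2 ^ d := Nat.choose_le_two_pow d e
  · rw [Multiset.mem_toFinset, mem_roots hR0, IsRoot, hR, Multiset.prod_eq_zero_iff,
      Multiset.mem_map]
    refine ⟨g.roots, ?_, ?_⟩
    · rw [Multiset.mem_powersetCard]
      exact ⟨roots.le_of_dvd (hmon T).ne_zero hdvd,
        by rw [splits_iff_card_roots.mp (IsAlgClosed.splits _), hge]⟩
    · have h1 := (IsAlgClosed.splits g).coeff_zero_eq_leadingCoeff_mul_prod_roots
      rw [hg.leadingCoeff, hge, hgu, mul_one] at h1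
      rw [h1, ← mul_assoc, ← mul_pow]
      simp

end FactorCount

/-! ### Integer polynomials and the possible data of a proper factor. -/

section MonicPoly
open Polynomial

lemma degree_sum_C_mul_X_pow_lt (d : ℕ) (a : ℕ → ℤ) :
    (∑ j ∈ Finset.range d, C (a j) * X ^ j).degree < (d : WithBot ℕ) := by
  refine (degree_sum_le _ _).trans_lt ((Finset.sup_lt_iff (WithBot.bot_lt_coe d)).mpr ?_)
  intro j hj
  exact (degree_C_mul_X_pow_le j _).trans_lt (WithBot.coe_lt_coe.mpr (Finset.mem_range.mp hj))

lemma monicPoly_monic (d : ℕ) (a : ℕ → ℤ) : (monicPoly d a).Monic :=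
  monic_X_pow_add (degree_sum_C_mul_X_pow_lt d a)

lemma natDegree_monicPoly (d : ℕ) (a : ℕ → ℤ) : (monicPoly d a).natDegree = d := by
  rw [monicPoly, natDegree_eq_of_degree_eq (degree_add_eq_left_of_degree_lt _), natDegree_X_pow]
  rw [degree_X_pow]
  exact degree_sum_C_mul_X_pow_lt d a

lemma coeff_monicPoly {d j : ℕ} (hj : j < d) (a : ℕ → ℤ) : (monicPoly d a).coeff j = a j := by
  simp [monicPoly, coeff_X_pow, hj.ne, hj]

lemma monicPoly_congr {d : ℕ} {a b : ℕ → ℤ} (h : ∀ j < d, a j = b j) :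
    monicPoly d a = monicPoly d b := by
  unfold monicPoly
  congr 1
  exact Finset.sum_congr rfl fun j hj => by rw [h j (Finset.mem_range.mp hj)]

lemma monicPoly_eq_update_add {d k : ℕ} (hk : k < d) (a : ℕ → ℤ) :
    monicPoly d a = monicPoly d (Function.update a k 0) + C (a k) * X ^ k := by
  have hk' : k ∈ Finset.range d := Finset.mem_range.mpr hk
  unfold monicPoly
  rw [← Finset.add_sum_erase _ _ hk', ← Finset.add_sum_erase _ (fun j =>
    C (Function.update a k 0 j) * X ^ j) hk']
  have : ∑ j ∈ (Finset.range d).erase k, C (Function.update a k 0 j) * X ^ j =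
      ∑ j ∈ (Finset.range d).erase k, C (a j) * X ^ j :=
    Finset.sum_congr rfl fun j hj => by rw [Function.update_of_ne (Finset.ne_of_mem_erase hj)]
  rw [this]
  simp
  ring

lemma exists_monic_factor {d : ℕ} (hd : 0 < d) {f : ℤ[X]} (hf : f.Monic)
    (hfd : f.natDegree = d) (h : ¬ Irreducible f) :
    ∃ g : ℤ[X], g.Monic ∧ 0 < g.natDegree ∧ g.natDegree < d ∧ g ∣ f := by
  rw [hf.irreducible_iff_natDegree'] at h
  push Not at h
  obtain ⟨g, g', hg, hg', hgg, hmem⟩ := h (by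
    rintro rfl
    simp at hfd
    omega)
  rw [Finset.mem_Ioc, hfd] at hmem
  exact ⟨g', hg', hmem.1, by omega, hgg ▸ dvd_mul_left _ _⟩

lemma exists_finset_int_factor {d k e : ℕ} (hk : 0 < k) (hkd : k < d)
    (hcop : Nat.Coprime k d) (he : 0 < e) (hed : e < d) {f : ℤ[X]} (hf : f.Monic)
    (hd : f.natDegree = d) (h0 : f.coeff 0 ≠ 0) (u : ℤ) :
    ∃ 𝒯 : Finset ℤ, 𝒯.card ≤ 2 ^ d ∧ ∀ T : ℤ, ∀ g : ℤ[X], g.Monic → g.natDegree = e →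
      g.coeff 0 = u → g ∣ f + C T * X ^ k → T ∈ 𝒯 := by
  obtain ⟨𝒯, h1, h2⟩ := exists_finset_factor hk hkd hcop he hed
    (hf.map (Int.castRingHom ℂ)) (by rw [hf.natDegree_map, hd]) (by simpa using h0) (u : ℂ)
  refine ⟨𝒯.preimage (fun n : ℤ => (n : ℂ)) Int.cast_injective.injOn, ?_, ?_⟩
  · exact (Finset.card_le_card_of_injOn (fun n : ℤ => (n : ℂ)) (fun n hn => by simpa using hn)
      Int.cast_injective.injOn).trans h1
  · intro T g hg hge hgu hdvd
    rw [Finset.mem_preimage]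
    refine h2 T (g.map (Int.castRingHom ℂ)) (hg.map _) (by rw [hg.natDegree_map, hge])
      (by simp [hgu]) ?_
    have := Polynomial.map_dvd (Int.castRingHom ℂ) hdvd
    simpa using this

/-- The pairs (degree, constant term) of the possible proper monic factors of a polynomial of degree
`d` with constant term `c`; the sign of the constant term is stored as a `Bool`. -/
def factorData (d : ℕ) (c : ℤ) : Finset (ℕ × ℕ × Bool) :=
  Finset.Ioo 0 d ×ˢ c.natAbs.divisors ×ˢ Finset.univ

lemma card_factorData (d : ℕ) (c : ℤ) : (factorData d c).card = (d - 1) * (tau c * 2) := by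
  simp [factorData, tau]

/-- For fixed coefficients other than the `k`-th, the values of the `k`-th coefficient giving
a reducible polynomial are covered by `2 (d - 1) τ(c)` sets of at most `2 ^ d` points. -/
lemma exists_finsets_of_not_irreducible {d k : ℕ} (hk : 0 < k) (hkd : k < d)
    (hcop : Nat.Coprime k d) {c : ℤ} (hc : c ≠ 0) (b : ℕ → ℤ) (hb : b 0 = c) (hbk : b k = 0) :
    ∃ 𝒯 : ℕ × ℕ × Bool → Finset ℤ, (∀ i, (𝒯 i).card ≤ 2 ^ d) ∧
      ∀ a : ℕ → ℤ, (∀ j < d, j ≠ k → a j = b j) → ¬ Irreducible (monicPoly d a) →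
        ∃ i ∈ factorData d c, a k ∈ 𝒯 i := by
  have hd : 0 < d := by omega
  -- The sets are chosen for all indices at once; for degrees outside `0 < e < d` the condition is
  -- vacuous and the empty set serves.
  have key : ∀ i : ℕ × ℕ × Bool, ∃ 𝒯 : Finset ℤ, 𝒯.card ≤ 2 ^ d ∧
      (0 < i.1 → i.1 < d → ∀ T : ℤ, ∀ g : ℤ[X], g.Monic → g.natDegree = i.1 →
      g.coeff 0 = (if i.2.2 then (i.2.1 : ℤ) else -(i.2.1 : ℤ)) →
      g ∣ monicPoly d b + C T * X ^ k → T ∈ 𝒯) := by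
    intro i
    by_cases hi : 0 < i.1 ∧ i.1 < d
    · obtain ⟨𝒯, h1, h2⟩ := exists_finset_int_factor hk hkd hcop hi.1 hi.2
        (monicPoly_monic d b) (natDegree_monicPoly d b) (by rw [coeff_monicPoly hd, hb]; exact hc)
        (if i.2.2 then (i.2.1 : ℤ) else -(i.2.1 : ℤ))
      exact ⟨𝒯, h1, fun _ _ => h2⟩
    · exact ⟨∅, by simp, fun h1 h2 => absurd ⟨h1, h2⟩ hi⟩
  choose 𝒯 h𝒯 h𝒯' using key
  refine ⟨𝒯, h𝒯, fun a ha hirr => ?_⟩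
  obtain ⟨g, hg, hg0, hgd, hdvd⟩ := exists_monic_factor hd (monicPoly_monic d a)
    (natDegree_monicPoly d a) hirr
  have hac : (monicPoly d a).coeff 0 = c := by
    rw [coeff_monicPoly hd, ha 0 hd hk.ne, hb]
  have hdc : g.coeff 0 ∣ c := by
    obtain ⟨h, hh⟩ := hdvd
    rw [← hac, hh, mul_coeff_zero]
    exact dvd_mul_right _ _
  refine ⟨(g.natDegree, (g.coeff 0).natAbs, decide (0 ≤ g.coeff 0)), ?_, ?_⟩
  · simp only [factorData, Finset.mem_product, Finset.mem_Ioo, Nat.mem_divisors, Finset.mem_univ,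
      and_true]
    exact ⟨⟨hg0, hgd⟩, Int.natAbs_dvd_natAbs.mpr hdc, by simpa using hc⟩
  · refine h𝒯' _ hg0 hgd (a k) g hg rfl ?_ ?_
    · by_cases h : 0 ≤ g.coeff 0
      · simp [h, abs_of_nonneg]
      · simp [h, abs_of_neg (not_le.mp h)]
    · rw [monicPoly_eq_update_add hkd a] at hdvd
      rwa [monicPoly_congr (a := Function.update a k 0) (b := b)] at hdvd
      intro j hj
      by_cases hjk : j = k
      · subst hjk; simp [hbk]
      · rw [Function.update_of_ne hjk, ha j hj hjk]

end MonicPoly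

/-! ### Small-mass estimates for product measures. -/

section ProductMeasure

/-- Fubini: fibres over the exceptional set `G` are bounded by `1`, the others by `ε`. -/
lemma prod_apply_le_add {α β : Type*} [MeasurableSpace α] [MeasurableSpace β]
    (ν : Measure α) [SFinite ν] (ρ : Measure β) [IsProbabilityMeasure ρ] {W : Set (α × β)}
    (hW : MeasurableSet W) {G : Set β} (hG : MeasurableSet G) [IsProbabilityMeasure ν]
    {ε δ : ℝ≥0∞} (hδ : ρ G ≤ δ) (hε : ∀ y ∉ G, ν {x | (x, y) ∈ W} ≤ ε) :
    ν.prod ρ W ≤ δ + ε := by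
  rw [Measure.prod_apply_symm hW]
  calc _ ≤ ∫⁻ y, (G.indicator 1 y + ε) ∂ρ := by
        refine lintegral_mono fun y => ?_
        by_cases hy : y ∈ G
        · exact prob_le_one.trans (by simp [hy])
        · exact (hε y hy).trans (by simp)
    _ = ρ G + ε := by
      rw [lintegral_add_right _ measurable_const, lintegral_indicator_one hG]
      simp
    _ ≤ _ := by gcongr

lemma measurableSet_eval_eq {n : ℕ} (p : MvPolynomial (Fin n) ℝ) (c : ℝ) :
    MeasurableSet {x : Fin n → ℝ | MvPolynomial.eval x p = c} :=
  (isClosed_eq (MvPolynomial.continuous_eval p) continuous_const).measurableSet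

/-- A Schwartz-Zippel bound for a product of probability measures giving small mass to all small
finite sets. -/
lemma pi_eval_eq_zero_le {N : ℕ} {ε : ℝ≥0∞} (n : ℕ) : ∀ (ν : Fin n → Measure ℝ)
    [∀ i, IsProbabilityMeasure (ν i)] (_ : ∀ i, ∀ T : Finset ℝ, T.card ≤ N → ν i T ≤ ε)
    (p : MvPolynomial (Fin n) ℝ), p ≠ 0 → (∀ i, p.degreeOf i ≤ N) →
    Measure.pi ν {x | MvPolynomial.eval x p = 0} ≤ n * ε := by
  induction n with
  | zero =>
    intro ν _ _ p hp _
    have : {x : Fin 0 → ℝ | MvPolynomial.eval x p = 0} = ∅ := by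
      ext x
      simp only [Set.mem_ofPred_eq, Set.mem_empty_iff_false, iff_false]
      obtain ⟨r, rfl⟩ := MvPolynomial.C_surjective (Fin 0) p
      intro h
      simp at h
      simp [h] at hp
    simp [this]
  | succ n ih =>
    intro ν _ hν p hp hdeg
    have hmp := measurePreserving_piFinSuccAbove ν 0
    set P := MvPolynomial.finSuccEquiv ℝ n p with hP
    have hP0 : P ≠ 0 := by simpa [hP] using hp
    have hPd : P.natDegree ≤ N := by rw [hP, MvPolynomial.natDegree_finSuccEquiv]; exact hdeg 0
    have hW : MeasurableSet {z : ℝ × (Fin n → ℝ) |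
        MvPolynomial.eval (Fin.cons z.1 z.2 : Fin (n + 1) → ℝ) p = 0} := by
      have : Measurable fun z : ℝ × (Fin n → ℝ) => (Fin.cons z.1 z.2 : Fin (n + 1) → ℝ) := by
        refine measurable_pi_iff.mpr fun i => ?_
        refine Fin.cases ?_ (fun j => ?_) i
        · simpa using measurable_fst
        · exact (measurable_pi_apply j).comp measurable_snd
      exact this (measurableSet_eval_eq p 0)
    have heq : {x : Fin (n + 1) → ℝ | MvPolynomial.eval x p = 0} =
        MeasurableEquiv.piFinSuccAbove (fun _ => ℝ) 0 ⁻¹' {z : ℝ × (Fin n → ℝ) |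
          MvPolynomial.eval (Fin.cons z.1 z.2 : Fin (n + 1) → ℝ) p = 0} := by
      ext x
      have : (Fin.cons (x 0) (fun j : Fin n => x j.succ) : Fin (n + 1) → ℝ) = x :=
        Fin.cons_self_tail x
      simp only [Set.mem_ofPred_eq, Set.mem_preimage]
      conv_lhs => rw [← this]
      rfl
    rw [heq, hmp.measure_preimage hW.nullMeasurableSet]
    -- The exceptional set is the zero set of the leading coefficient in variable `0`, small by
    -- induction. Off it the specialised polynomial is nonzero, with at most `N` roots.
    have h1 := prod_apply_le_add (ν 0) (Measure.pi fun j => ν (Fin.succAbove 0 j)) hW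
      (measurableSet_eval_eq P.leadingCoeff 0) (δ := n * ε) (ε := ε)
      (ih _ (fun i => hν _) _ (Polynomial.leadingCoeff_ne_zero.mpr hP0)
        fun i => (MvPolynomial.degreeOf_coeff_finSuccEquiv p i _).trans (hdeg _)) (by
        intro y hy
        simp only [Set.mem_ofPred_eq] at hy
        have h0 : P.map (MvPolynomial.eval y) ≠ 0 := by
          intro h0
          have := congrArg (fun Q => Q.coeff P.natDegree) h0
          simp only [Polynomial.coeff_map, Polynomial.coeff_zero] at this
          exact hy this
        refine le_trans (measure_mono ?_) (hν 0 (P.map (MvPolynomial.eval y)).roots.toFinset ?_)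
        · intro x hx
          simp only [Set.mem_ofPred_eq, MvPolynomial.eval_eq_eval_mv_eval'] at hx
          simpa [h0] using hx
        · exact (Multiset.toFinset_card_le _).trans ((Polynomial.card_roots' _).trans
            (Polynomial.natDegree_map_le.trans hPd)))
    refine h1.trans (le_of_eq ?_)
    push_cast
    ring

/-- A polynomial of positive degree in the last variable, seen as a univariate polynomial. -/
lemma exists_univariate_last {n L : ℕ} {q : MvPolynomial (Fin (n + 1)) ℝ}
    (hpos : 0 < q.degreeOf (Fin.last n)) (hdeg : ∀ i, q.degreeOf i ≤ L) :
    ∃ (P : (Fin n → ℝ) → Polynomial ℝ) (l : MvPolynomial (Fin n) ℝ), l ≠ 0 ∧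
      (∀ i, l.degreeOf i ≤ L) ∧
      (∀ s y, (P s).eval y = MvPolynomial.eval (Fin.snoc s y : Fin (n + 1) → ℝ) q) ∧
      (∀ s, (P s).natDegree ≤ L) ∧
      ∀ s, MvPolynomial.eval s l ≠ 0 → 0 < (P s).natDegree := by
  -- `finSuccEquiv` singles out variable `0`, so the last variable is rotated to the front.
  set σ := finRotate (n + 1)
  set q' := MvPolynomial.rename σ q with hq'
  have hd' : ∀ i, q'.degreeOf (σ i) = q.degreeOf i := fun i =>
    MvPolynomial.degreeOf_rename_of_injective σ.injective i
  have hd0 : q'.degreeOf 0 = q.degreeOf (Fin.last n) := by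
    rw [← hd', finRotate_last]
  have hdL : ∀ i, q'.degreeOf i ≤ L := fun i => by
    rw [← σ.apply_symm_apply i, hd']; exact hdeg _
  set P := MvPolynomial.finSuccEquiv ℝ n q' with hP
  have hPd : P.natDegree = q.degreeOf (Fin.last n) := by
    rw [hP, MvPolynomial.natDegree_finSuccEquiv, hd0]
  refine ⟨fun s => P.map (MvPolynomial.eval s), P.leadingCoeff, ?_, ?_, ?_, ?_, ?_⟩
  · rw [Polynomial.leadingCoeff_ne_zero]
    rintro h
    rw [h] at hPd
    simp at hPd
    omega
  · exact fun i => (MvPolynomial.degreeOf_coeff_finSuccEquiv q' i _).trans (hdL _)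
  · intro s y
    rw [← MvPolynomial.eval_eq_eval_mv_eval', hq', MvPolynomial.eval_rename,
      Fin.snoc_eq_cons_rotate]
    rfl
  · intro s
    exact Polynomial.natDegree_map_le.trans (hPd.le.trans (hdeg _))
  · intro s hs
    refine lt_of_lt_of_le (hPd ▸ hpos) (Polynomial.le_natDegree_of_ne_zero ?_)
    rwa [Polynomial.coeff_map]

/-- If, for fixed values of the other variables, membership in `W` forces `q` to take a value in
one of `J` sets of at most `K` points, then `W` has small mass. -/
lemma pi_le_of_eval_mem {n L K : ℕ} (hK : 1 ≤ K) {ε : ℝ≥0∞} (ν : Fin (n + 1) → Measure ℝ)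
    [∀ i, IsProbabilityMeasure (ν i)]
    (hν : ∀ i, ∀ T : Finset ℝ, T.card ≤ K * L → ν i T ≤ ε)
    {q : MvPolynomial (Fin (n + 1)) ℝ} (hpos : 0 < q.degreeOf (Fin.last n))
    (hdeg : ∀ i, q.degreeOf i ≤ L) {W : Set (Fin (n + 1) → ℝ)} (hW : MeasurableSet W)
    {ι : Type*} (J : Finset ι)
    (h : ∀ s : Fin n → ℝ, ∃ 𝒯 : ι → Finset ℝ, (∀ i, (𝒯 i).card ≤ K) ∧
      ∀ y : ℝ, (Fin.snoc s y : Fin (n + 1) → ℝ) ∈ W →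
        ∃ i ∈ J, MvPolynomial.eval (Fin.snoc s y : Fin (n + 1) → ℝ) q ∈ 𝒯 i) :
    Measure.pi ν W ≤ (n + J.card) * ε := by
  classical
  obtain ⟨P, l, hl0, hld, hPe, hPd, hPpos⟩ := exists_univariate_last hpos hdeg
  have hmp := measurePreserving_piFinSuccAbove ν (Fin.last n)
  have hW' := (MeasurableEquiv.piFinSuccAbove (fun _ => ℝ) (Fin.last n)).symm.measurable hW
  have heq : W = MeasurableEquiv.piFinSuccAbove (fun _ => ℝ) (Fin.last n) ⁻¹'
      ((MeasurableEquiv.piFinSuccAbove (fun _ => ℝ) (Fin.last n)).symm ⁻¹' W) := by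
    ext x; simp
  rw [heq, hmp.measure_preimage hW'.nullMeasurableSet, add_mul]
  have hNL : L ≤ K * L := Nat.le_mul_of_pos_left L hK
  refine prod_apply_le_add _ _ hW' (measurableSet_eval_eq l 0)
    (pi_eval_eq_zero_le n _ (fun i => hν _) l hl0 fun i => (hld i).trans hNL) ?_
  intro s hs
  have hs' := hPpos s hs
  obtain ⟨𝒯, h𝒯, h'⟩ := h s
  calc _ ≤ ν (Fin.last n) (⋃ i ∈ J, (((𝒯 i).biUnion fun T =>
        (P s - Polynomial.C T).roots.toFinset : Finset ℝ) : Set ℝ)) := by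
        refine measure_mono fun y hy => ?_
        have hy' : (Fin.snoc s y : Fin (n + 1) → ℝ) ∈ W := by
          have h2 : (Fin.last n).insertNth y s = (Fin.snoc s y : Fin (n + 1) → ℝ) :=
            Fin.insertNth_last' y s
          rw [← h2]
          exact hy
        obtain ⟨i, hi, hm⟩ := h' y hy'
        simp only [Set.mem_iUnion]
        refine ⟨i, hi, ?_⟩
        rw [Finset.mem_coe, Finset.mem_biUnion]
        refine ⟨_, hm, ?_⟩
        have hne : P s - Polynomial.C (MvPolynomial.eval (Fin.snoc s y : Fin (n + 1) → ℝ) q) ≠ 0 := by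
          intro h0
          rw [sub_eq_zero.mp h0, Polynomial.natDegree_C] at hs'
          exact lt_irrefl _ hs'
        rw [Multiset.mem_toFinset, Polynomial.mem_roots hne]
        simp [hPe]
    _ ≤ ∑ i ∈ J, ν (Fin.last n) (((𝒯 i).biUnion fun T =>
        (P s - Polynomial.C T).roots.toFinset : Finset ℝ) : Set ℝ) := measure_biUnion_finset_le _ _
    _ ≤ ∑ i ∈ J, ε := by
      refine Finset.sum_le_sum fun i _ => hν _ _ ?_
      refine (Finset.card_biUnion_le_card_mul _ _ L fun T _ => ?_).trans
        (Nat.mul_le_mul_right L (h𝒯 i))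
      refine (Multiset.toFinset_card_le _).trans ((Polynomial.card_roots' _).trans ?_)
      rw [Polynomial.natDegree_sub_C]
      exact hPd s
    _ = _ := by simp

end ProductMeasure

lemma totalDegree_aeval_le {σ τ : Type*} (g : σ → MvPolynomial τ ℝ)
    (hg : ∀ i, (g i).totalDegree ≤ 1) (F : MvPolynomial σ ℝ) :
    (MvPolynomial.aeval g F).totalDegree ≤ F.totalDegree := by
  rw [MvPolynomial.aeval_def, MvPolynomial.eval₂_eq]
  refine MvPolynomial.totalDegree_finsetSum_le fun s hs => ?_
  refine (MvPolynomial.totalDegree_mul _ _).trans ?_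
  rw [MvPolynomial.algebraMap_eq, MvPolynomial.totalDegree_C, zero_add]
  refine (MvPolynomial.totalDegree_finsetProd _ _).trans ?_
  refine le_trans (Finset.sum_le_sum fun i _ => ?_) (MvPolynomial.le_totalDegree hs)
  exact (MvPolynomial.totalDegree_pow _ _).trans (by simpa using Nat.mul_le_mul_left (s i) (hg i))

/-- Monotonicity in `|T|` and `|S|` needs `0 ≤ C`, which the mass of a singleton forces when `N ≥
1`; for `N = 0` only `T = ∅` occurs. -/
lemma IsUniform.apply_le {C : ℝ} {N H : ℕ} {S : Finset ℝ} {D : Measure ℝ}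
    [IsProbabilityMeasure D] (h : IsUniform C N S D) (hH : 1 ≤ H) (hS : H ≤ S.card)
    {T : Finset ℝ} (hT : T.card ≤ N) : D T ≤ ENNReal.ofReal (C * N / H) := by
  have hS0 : (0 : ℝ) < S.card := by exact_mod_cast (show 0 < S.card by omega)
  have hH0 : (0 : ℝ) < H := by exact_mod_cast hH
  rw [← ofReal_measureReal]
  refine ENNReal.ofReal_le_ofReal ((h.2 T hT).trans ?_)
  rcases Nat.eq_zero_or_pos N with rfl | hN
  · simp [Nat.le_zero.mp hT]
  · obtain ⟨x, -⟩ := Finset.card_pos.mp (show 0 < S.card by omega)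
    have h1 := measureReal_nonneg.trans (h.2 {x} (by rw [Finset.card_singleton]; omega))
    have hC : 0 ≤ C := by
      by_contra! hC
      have : C * (({x} : Finset ℝ).card : ℝ) / S.card < 0 := by
        simpa using div_neg_of_neg_of_pos hC hS0
      linarith
    have hTN : (T.card : ℝ) ≤ N := by exact_mod_cast hT
    have hHS : (H : ℝ) ≤ S.card := by exact_mod_cast hS
    gcongr

/-! ### The model with a fixed nonzero constant term. -/

section FixedConstantTerm

variable {d k m L H : ℕ} {C : ℝ} {F₁ : ℕ → MvPolynomial (Fin m) ℝ}
  {F₂ : MvPolynomial (Fin (m + 1)) ℝ}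

/-- The values of `(t₁, …, t_m)` for which the model with constant coefficient `c` has integer
coefficients and gives a reducible polynomial. -/
def badInputs (d k : ℕ) (F₁ : ℕ → MvPolynomial (Fin m) ℝ) (F₂ : MvPolynomial (Fin (m + 1)) ℝ)
    (c : ℤ) : Set (Fin m → ℝ) :=
  {x | ∃ b : ℕ → ℤ, b 0 = c ∧ ¬ Irreducible (monicPoly d b) ∧
    (∀ j, 1 ≤ j → j < d → j ≠ k →
      (b j : ℝ) = MvPolynomial.eval (fun i : Fin m => inputs c x i.castSucc) (F₁ j)) ∧
    (b k : ℝ) = MvPolynomial.eval (inputs c x) F₂}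

lemma measurable_inputs (c : ℤ) (i : Fin (m + 1)) :
    Measurable fun x : Fin m → ℝ => inputs c x i := by
  refine Fin.cases ?_ (fun j => ?_) i
  · exact measurable_const
  · exact measurable_pi_apply j

/-- Integer coefficient vectors are countable in number, and each one gives a closed condition or
none. -/
lemma measurableSet_badInputs (hkd : k < d) (c : ℤ) :
    MeasurableSet (badInputs d k F₁ F₂ c) := by
  have hd : 0 < d := by omega
  let ext (v : Fin d → ℤ) (j : ℕ) : ℤ := if h : j < d then v ⟨j, h⟩ else 0
  have heq : badInputs d k F₁ F₂ c = ⋃ v : Fin d → ℤ, ⋃ _ : ext v 0 = c ∧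
      ¬ Irreducible (monicPoly d (ext v)), ((⋂ j : ℕ, ⋂ _ : 1 ≤ j ∧ j < d ∧ j ≠ k,
        {x : Fin m → ℝ | MvPolynomial.eval (fun i : Fin m => inputs c x i.castSucc) (F₁ j) =
          (ext v j : ℝ)}) ∩
        {x : Fin m → ℝ | MvPolynomial.eval (inputs c x) F₂ = (ext v k : ℝ)}) := by
    ext x
    simp only [badInputs, Set.mem_iUnion, Set.mem_inter_iff, Set.mem_iInter, Set.mem_ofPred_eq]
    constructor
    · rintro ⟨b, h0, hirr, h1, h2⟩
      have hb : ∀ j < d, ext (fun i => b i) j = b j := fun j hj => by simp [ext, hj]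
      refine ⟨fun i => b i, ⟨by rw [hb 0 hd, h0], by rwa [monicPoly_congr hb]⟩, ?_, ?_⟩
      · rintro j ⟨hj1, hj2, hj3⟩
        rw [hb j hj2, h1 j hj1 hj2 hj3]
      · rw [hb k hkd, h2]
    · rintro ⟨v, ⟨h0, hirr⟩, h1, h2⟩
      exact ⟨ext v, h0, hirr, fun j hj1 hj2 hj3 => (h1 j ⟨hj1, hj2, hj3⟩).symm, h2.symm⟩
  rw [heq]
  refine MeasurableSet.iUnion fun v => MeasurableSet.iUnion fun _ => MeasurableSet.inter
    (MeasurableSet.iInter fun j => MeasurableSet.iInter fun _ => ?_) ?_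
  · exact (measurable_pi_iff.mpr fun i : Fin m => measurable_inputs c i.castSucc)
      (measurableSet_eval_eq (F₁ j) _)
  · exact (measurable_pi_iff.mpr fun i => measurable_inputs c i) (measurableSet_eval_eq F₂ _)

lemma fixFirst_eq_rename (c : ℝ) (F : MvPolynomial (Fin (m + 1)) ℝ) :
    fixFirst c F = MvPolynomial.rename Fin.succ
      (MvPolynomial.aeval (Fin.cons (MvPolynomial.C c) MvPolynomial.X :
        Fin (m + 1) → MvPolynomial (Fin m) ℝ) F) := by
  rw [fixFirst, MvPolynomial.bind₁, ← AlgHom.comp_apply, MvPolynomial.comp_aeval]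
  congr 2
  funext i
  refine Fin.cases ?_ (fun j => ?_) i
  · simp
  · simp [Fin.succ_ne_zero]

lemma pi_badInputs_le (hm : 0 < m) (hk : 0 < k) (hkd : k < d) (hcop : Nat.Coprime k d)
    (hF₂ : F₂.totalDegree ≤ L) {c : ℤ} (hc : c ≠ 0)
    (hpos : 0 < (fixFirst (c : ℝ) F₂).degreeOf (Fin.last m)) {ε : ℝ≥0∞}
    (ν : Fin m → Measure ℝ) [∀ i, IsProbabilityMeasure (ν i)]
    (hν : ∀ i, ∀ T : Finset ℝ, T.card ≤ 2 ^ d * L → ν i T ≤ ε) :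
    Measure.pi ν (badInputs d k F₁ F₂ c) ≤ (2 * d * m * tau c : ℕ) * ε := by
  obtain ⟨n, rfl⟩ : ∃ n, m = n + 1 := ⟨m - 1, by omega⟩
  have hd : 0 < d := by omega
  set q := MvPolynomial.aeval (Fin.cons (MvPolynomial.C (c : ℝ)) MvPolynomial.X :
        Fin (n + 1 + 1) → MvPolynomial (Fin (n + 1)) ℝ) F₂ with hq
  have hqpos : 0 < q.degreeOf (Fin.last n) := by
    rw [fixFirst_eq_rename, ← Fin.succ_last,
      MvPolynomial.degreeOf_rename_of_injective (Fin.succ_injective _)] at hpos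
    exact hpos
  have hqdeg : ∀ i, q.degreeOf i ≤ L := fun i => by
    refine (MvPolynomial.degreeOf_le_totalDegree q i).trans
      ((totalDegree_aeval_le _ (fun i => ?_) F₂).trans hF₂)
    refine Fin.cases ?_ (fun j => ?_) i
    · rw [Fin.cons_zero, MvPolynomial.totalDegree_C]
      exact zero_le_one
    · rw [Fin.cons_succ, MvPolynomial.totalDegree_X]
  have hqeval : ∀ x, MvPolynomial.eval x q = MvPolynomial.eval (inputs c x) F₂ := fun x => by
    rw [hq, ← MvPolynomial.coe_aeval_eq_eval, ← MvPolynomial.coe_aeval_eq_eval]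
    simp only [RingHom.coe_coe]
    rw [← AlgHom.comp_apply, MvPolynomial.comp_aeval]
    congr 2
    funext i
    refine Fin.cases ?_ (fun j => ?_) i
    · simp [inputs]
    · simp [inputs]
  have h1 := pi_le_of_eval_mem (K := 2 ^ d) Nat.one_le_two_pow ν hν hqpos hqdeg
    (measurableSet_badInputs (F₁ := F₁) (F₂ := F₂) hkd c) (factorData d c) (by
    classical
    intro s
    -- One bad point of the fibre over `s` determines all coefficients but the `k`-th along the
    -- whole fibre, since `F₁` does not see the last variable. A fibre without bad points needs no
    -- exceptional values.
    by_cases hs : ∃ y : ℝ, (Fin.snoc s y : Fin (n + 1) → ℝ) ∈ badInputs d k F₁ F₂ c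
    · obtain ⟨y₀, b, hb0, -, hb1, -⟩ := hs
      obtain ⟨𝒯, h𝒯, h𝒯'⟩ := exists_finsets_of_not_irreducible hk hkd hcop hc
        (Function.update b k 0) (by rw [Function.update_of_ne hk.ne, hb0]) (by simp)
      refine ⟨fun i => (𝒯 i).image (fun z : ℤ => (z : ℝ)),
        fun i => Finset.card_image_le.trans (h𝒯 i), ?_⟩
      rintro y ⟨b', hb0', hirr, hb1', hb2'⟩
      obtain ⟨i, hi, hmem⟩ := h𝒯' b' (fun j hj hjk => by
        rw [Function.update_of_ne hjk]
        rcases Nat.eq_zero_or_pos j with rfl | hj0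
        · rw [hb0, hb0']
        · have e1 := hb1 j hj0 hj hjk
          have e2 := hb1' j hj0 hj hjk
          have e3 : ∀ y : ℝ, (fun i : Fin (n + 1) =>
              inputs c (Fin.snoc s y : Fin (n + 1) → ℝ) i.castSucc) =
                (Fin.cons (c : ℝ) s : Fin (n + 1) → ℝ) := by
            intro y
            funext i
            refine Fin.cases ?_ (fun l => ?_) i
            · simp [inputs]
            · simp only [inputs, Fin.cons_succ, Fin.castSucc_succ]
              exact Fin.snoc_castSucc (α := fun _ => ℝ) y s l
          rw [e3] at e1 e2
          exact_mod_cast e2.trans e1.symm) hirr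
      refine ⟨i, hi, ?_⟩
      rw [hqeval, ← hb2']
      exact Finset.mem_image_of_mem _ hmem
    · exact ⟨fun _ => ∅, by simp, fun y hy => absurd ⟨y, hy⟩ hs⟩)
  refine h1.trans ?_
  gcongr
  rw [card_factorData]
  -- `1 ≤ τ(c)` lets `n + 2 (d - 1) τ(c)` be absorbed in `2 d (n + 1) τ(c)`.
  have ht : 1 ≤ tau c := Finset.card_pos.mpr ⟨1, by simpa [Nat.mem_divisors] using hc⟩
  norm_cast
  obtain ⟨d', rfl⟩ : ∃ d', d = d' + 1 := ⟨d - 1, by omega⟩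
  simp only [Nat.add_sub_cancel]
  calc n + d' * (tau c * 2) ≤ n * tau c + d' * (tau c * 2) := by gcongr; nlinarith
    _ ≤ _ := by
      have : 0 ≤ d' * n * tau c := by positivity
      have : 0 ≤ n * tau c := by positivity
      nlinarith

end FixedConstantTerm

/-! ### Summation over the values of the constant term. -/

variable {Ω : Type u} [MeasurableSpace Ω]

/-- Independence makes the law of the inputs a product, so the events `a₀ = c` and `t ∈ badInputs`
factor. Null values of `c` are treated apart because `nondeg` is assumed only for values of positive
probability. -/
lemma Model.measure_not_irreducible_le {μ : Measure Ω} [IsProbabilityMeasure μ]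
    {d k m L H : ℕ} {C : ℝ} {a : ℕ → Ω → ℤ} {t : Fin m → Ω → ℝ}
    {F₁ : ℕ → MvPolynomial (Fin m) ℝ} {F₂ : MvPolynomial (Fin (m + 1)) ℝ}
    {S : Fin m → Finset ℝ} (hH : 1 ≤ H) (h : Model d k m L H C μ a t F₁ F₂ S) {c : ℤ}
    (hc : c ≠ 0) :
    μ ((irredEvent d a)ᶜ ∩ {ω | a 0 ω = c}) ≤
      μ {ω | a 0 ω = c} *
        ((2 * d * m * tau c : ℕ) * ENNReal.ofReal (C * (2 ^ d * L : ℕ) / H)) := by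
  rcases eq_or_ne (μ {ω | a 0 ω = c}) 0 with h0 | h0
  · rw [h0, zero_mul]
    exact (measure_mono Set.inter_subset_right).trans h0.le
  have hmeas : ∀ i : Fin (m + 1), Measurable fun ω => inputs (a 0 ω) (fun l => t l ω) i := by
    intro i
    refine Fin.cases ?_ (fun j => ?_) i
    · exact (measurable_from_top (f := fun z : ℤ => (z : ℝ))).comp h.measurable_a
    · exact h.measurable_t j
  have hprob : ∀ i, IsProbabilityMeasure
      (μ.map fun ω => inputs (a 0 ω) (fun l => t l ω) i) := fun i =>
    Measure.isProbabilityMeasure_map (hmeas i).aemeasurable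
  have hlaw := (iIndepFun_iff_map_fun_eq_pi_map fun i => (hmeas i).aemeasurable).mp h.indep
  set ν := fun i => μ.map fun ω => inputs (a 0 ω) (fun l => t l ω) i with hν
  have hmp := measurePreserving_piFinSuccAbove ν 0
  have hBm := measurableSet_badInputs (F₁ := F₁) (F₂ := F₂) h.k_lt c
  have hbad : ∀ i : Fin m, ∀ T : Finset ℝ, T.card ≤ 2 ^ d * L →
      ν (Fin.succAbove 0 i) T ≤ ENNReal.ofReal (C * (2 ^ d * L : ℕ) / H) := fun i T hT =>
    have : IsProbabilityMeasure (μ.map (t i)) :=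
      Measure.isProbabilityMeasure_map (h.measurable_t i).aemeasurable
    (h.uniform i).apply_le hH (h.card_le i) hT
  have hpi := pi_badInputs_le (F₁ := F₁) h.m_pos h.k_pos h.k_lt h.k_coprime h.deg₂ hc
    (h.nondeg c hc h0) (fun i => ν (Fin.succAbove 0 i)) hbad
  have hsub : μ ((irredEvent d a)ᶜ ∩ {ω | a 0 ω = c}) ≤
      μ {ω | (fun i => inputs (a 0 ω) (fun l => t l ω) i) ∈
        MeasurableEquiv.piFinSuccAbove (fun _ => ℝ) 0 ⁻¹'
          (({(c : ℝ)} : Set ℝ) ×ˢ badInputs d k F₁ F₂ c)} := by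
    refine measure_mono_ae ?_
    have h1 : ∀ᵐ ω ∂μ, ∀ j, 1 ≤ j → j < d → j ≠ k → (a j ω : ℝ) =
        MvPolynomial.eval (fun i : Fin m => inputs (a 0 ω) (fun l => t l ω) i.castSucc)
          (F₁ j) := by
      refine ae_all_iff.mpr fun j => ?_
      by_cases hj : 1 ≤ j ∧ j < d ∧ j ≠ k
      · filter_upwards [h.eq₁ j hj.1 hj.2.1 hj.2.2] with ω hω _ _ _ using hω
      · exact Filter.Eventually.of_forall fun ω h1 h2 h3 => absurd ⟨h1, h2, h3⟩ hj
    filter_upwards [h1, h.eq₂] with ω hω1 hω2 hω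
    obtain ⟨hirr, hac⟩ := hω
    simp only [Set.mem_ofPred_eq] at hac
    refine ⟨?_, fun j => a j ω, hac, hirr, ?_, ?_⟩
    · change ((a 0 ω : ℤ) : ℝ) = c
      rw [hac]
    · rw [hac] at hω1
      exact hω1
    · rw [hac] at hω2
      exact hω2
  have hsm : MeasurableSet (({(c : ℝ)} : Set ℝ) ×ˢ badInputs d k F₁ F₂ c) :=
    (measurableSet_singleton _).prod hBm
  have hcoe : ν 0 {(c : ℝ)} = μ {ω | a 0 ω = c} := by
    rw [hν]
    simp only
    rw [Measure.map_apply (hmeas 0) (measurableSet_singleton _)]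
    congr 1
    ext ω
    simp [inputs]
  calc _ ≤ _ := hsub
    _ = (μ.map fun ω i => inputs (a 0 ω) (fun l => t l ω) i)
        (MeasurableEquiv.piFinSuccAbove (fun _ => ℝ) 0 ⁻¹'
          (({(c : ℝ)} : Set ℝ) ×ˢ badInputs d k F₁ F₂ c)) := by
      rw [Measure.map_apply (measurable_pi_iff.mpr hmeas)
        ((MeasurableEquiv.piFinSuccAbove (fun _ => ℝ) 0).measurable hsm)]
      rfl
    _ = ν 0 {(c : ℝ)} * Measure.pi (fun i => ν (Fin.succAbove 0 i))
        (badInputs d k F₁ F₂ c) := by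
      rw [hlaw, hmp.measure_preimage hsm.nullMeasurableSet, Measure.prod_prod]
    _ ≤ _ := by
      rw [hcoe]
      gcongr

lemma tau_zero : tau 0 = 0 := by simp [tau]

lemma setLIntegral_tau {μ : Measure Ω} {X : Ω → ℤ} (hX : Measurable X) :
    ∫⁻ ω in {ω | X ω ≠ 0}, (tau (X ω) : ℝ≥0∞) ∂μ = ∑' c : ℤ, (tau c : ℝ≥0∞) * μ {ω | X ω = c} := by
  have hm : MeasurableSet {ω | X ω ≠ 0} := hX (measurableSet_singleton (0 : ℤ)).compl
  rw [← lintegral_indicator hm]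
  have : ({ω | X ω ≠ 0}.indicator fun ω => (tau (X ω) : ℝ≥0∞)) =
      fun ω => (fun c : ℤ => (tau c : ℝ≥0∞)) (X ω) := by
    funext ω
    by_cases h : X ω = 0
    · simp [h, tau_zero]
    · simp [h]
  rw [this, ← lintegral_map (f := fun c : ℤ => (tau c : ℝ≥0∞)) measurable_from_top hX,
    lintegral_countable']
  refine tsum_congr fun c => ?_
  rw [Measure.map_apply hX (measurableSet_singleton c)]
  rfl

/-- The additive form in `[0, ∞]` makes sense for an infinite expectation. Only covering and
subadditivity are used, so measurability of `irredEvent` is not needed. -/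
theorem Model.one_le_measure_irredEvent_add {μ : Measure Ω} [IsProbabilityMeasure μ]
    {d k m L H : ℕ} {C : ℝ} {a : ℕ → Ω → ℤ} {t : Fin m → Ω → ℝ}
    {F₁ : ℕ → MvPolynomial (Fin m) ℝ} {F₂ : MvPolynomial (Fin (m + 1)) ℝ}
    {S : Fin m → Finset ℝ} (hH : 1 ≤ H) (h : Model d k m L H C μ a t F₁ F₂ S) :
    1 ≤ μ (irredEvent d a) + ENNReal.ofReal (2 * C * d * m * 2 ^ d * L / H) *
      (∫⁻ ω in {ω | a 0 ω ≠ 0}, (tau (a 0 ω) : ℝ≥0∞) ∂μ) + μ {ω | a 0 ω = 0} := by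
  have hK : ∀ c : ℤ, ((2 * d * m * tau c : ℕ) : ℝ≥0∞) *
      ENNReal.ofReal (C * (2 ^ d * L : ℕ) / H) =
      ENNReal.ofReal (2 * C * d * m * 2 ^ d * L / H) * tau c := by
    intro c
    have : 2 * C * d * m * 2 ^ d * L / H = (2 * d * m : ℕ) * (C * (2 ^ d * L : ℕ) / H) := by
      push_cast; ring
    rw [this, ENNReal.ofReal_mul (Nat.cast_nonneg _), ENNReal.ofReal_natCast]
    push_cast
    ring
  have hcover : (Set.univ : Set Ω) ⊆ (irredEvent d a ∪
      ⋃ c : ℤ, ((irredEvent d a)ᶜ ∩ {ω | a 0 ω = c}) \ {ω | a 0 ω = 0}) ∪ {ω | a 0 ω = 0} := by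
    intro ω _
    by_cases h0 : a 0 ω = 0
    · exact Or.inr h0
    · by_cases hirr : ω ∈ irredEvent d a
      · exact Or.inl (Or.inl hirr)
      · exact Or.inl (Or.inr (Set.mem_iUnion.mpr ⟨a 0 ω, ⟨hirr, rfl⟩, h0⟩))
  calc (1 : ℝ≥0∞) = μ Set.univ := measure_univ.symm
    _ ≤ _ := measure_mono hcover
    _ ≤ _ := measure_union_le _ _
    _ ≤ (μ (irredEvent d a) + μ (⋃ c : ℤ,
        ((irredEvent d a)ᶜ ∩ {ω | a 0 ω = c}) \ {ω | a 0 ω = 0})) + μ {ω | a 0 ω = 0} := by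
      gcongr
      exact measure_union_le _ _
    _ ≤ _ := by
      gcongr
      refine (measure_iUnion_le _).trans ?_
      rw [setLIntegral_tau h.measurable_a, ← ENNReal.tsum_mul_left]
      refine ENNReal.tsum_le_tsum fun c => ?_
      rcases eq_or_ne c 0 with rfl | hc
      · refine le_trans (le_of_eq ?_) zero_le
        have : ((irredEvent d a)ᶜ ∩ {ω | a 0 ω = 0}) \ {ω | a 0 ω = 0} = ∅ := by
          ext ω; simp
        rw [this, measure_empty]
      · refine (measure_mono Set.sdiff_subset).trans
          ((h.measure_not_irreducible_le hH hc).trans (le_of_eq ?_))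
        rw [hK]
        ring

/-! ### Bounds and moments for the divisor function. -/

section DivisorBounds

lemma card_divisors_mul_le (m n : ℕ) :
    (m * n).divisors.card ≤ m.divisors.card * n.divisors.card := by
  rcases eq_or_ne m 0 with rfl | hm
  · simp
  rcases eq_or_ne n 0 with rfl | hn
  · simp
  rw [← Finset.card_product]
  refine (Finset.card_le_card (t := (m.divisors ×ˢ n.divisors).image fun x => x.1 * x.2) ?_).trans
    Finset.card_image_le
  intro d hd
  obtain ⟨a, b, ha, hb, rfl⟩ := (Nat.dvd_mul).mp (Nat.dvd_of_mem_divisors hd)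
  exact Finset.mem_image.mpr ⟨(a, b), Finset.mem_product.mpr
    ⟨Nat.mem_divisors.mpr ⟨ha, hm⟩, Nat.mem_divisors.mpr ⟨hb, hn⟩⟩, rfl⟩

lemma card_divisors_pow_le (n r : ℕ) : (n ^ r).divisors.card ≤ n.divisors.card ^ r := by
  induction r with
  | zero => simp
  | succ r ih =>
    rw [pow_succ, pow_succ]
    exact (card_divisors_mul_le _ _).trans (Nat.mul_le_mul_right _ ih)

lemma card_divisors_le_of_dvd {m n : ℕ} (h : m ∣ n) (hn : n ≠ 0) :
    m.divisors.card ≤ n.divisors.card :=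
  Finset.card_le_card (Nat.divisors_subset_of_dvd hn h)

/-- Removing a prime factor, which exceeds `w`, lowers the exponent `j` by one and at most halves
the number of divisors. -/
lemma card_divisors_le_two_pow {w : ℕ} (j : ℕ) : ∀ n : ℕ, 0 < n → n ≤ w ^ j →
    (∀ p, p.Prime → p ∣ n → w < p) → n.divisors.card ≤ 2 ^ j := by
  induction j with
  | zero =>
    intro n hn hnw _
    obtain rfl : n = 1 := by simp at hnw; omega
    simp
  | succ j ih =>
    intro n hn hnw hp
    rcases eq_or_ne n 1 with rfl | h1
    · simpa using Nat.one_le_two_pow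
    · obtain ⟨n', hn'⟩ := n.minFac_dvd
      have hpr := Nat.minFac_prime h1
      have hw := hp _ hpr n.minFac_dvd
      set p := n.minFac
      have hn0 : 0 < n' := Nat.pos_of_ne_zero (by rintro rfl; omega)
      have hle : n' ≤ w ^ j := by
        by_contra! hlt
        have : w ^ (j + 1) < n := by
          rw [hn', pow_succ']
          calc w * w ^ j ≤ p * w ^ j := by gcongr
            _ < p * n' := Nat.mul_lt_mul_of_pos_left hlt hpr.pos
        omega
      have := ih n' hn0 hle fun q hq hqd => hp q hq (hn' ▸ Dvd.dvd.mul_left hqd p)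
      rw [hn']
      refine (card_divisors_mul_le _ _).trans ?_
      rw [pow_succ', hpr.divisors, Finset.card_pair hpr.ne_one.symm]
      exact Nat.mul_le_mul_left 2 this

/-- The divisor function of `n` is controlled by that of a small divisor of `n`. -/
lemma exists_small_divisor {w : ℕ} (hw : 1 ≤ w) (j : ℕ) : ∀ n : ℕ, 0 < n → n ≤ w ^ j →
    ∃ q, q ∣ n ∧ q ≤ w ^ 2 ∧ n.divisors.card ≤ 2 ^ j * q.divisors.card ^ j := by
  induction j with
  | zero =>
    intro n hn hnw
    obtain rfl : n = 1 := by simp at hnw; omega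
    exact ⟨1, dvd_rfl, Nat.one_le_pow _ _ hw, by simp⟩
  | succ j ih =>
    intro n hn hnw
    -- `q` is the largest divisor up to `w ^ 2`. If `q ≥ w`, the cofactor is at most `w ^ j`;
    -- induction applies and the divisor with larger `τ` is kept. If `q < w`, a prime `p ≤ w` of the
    -- cofactor would give the larger divisor `q p ≤ w ^ 2`, so all its primes exceed `w`.
    obtain ⟨q, hq, hmax⟩ := (n.divisors.filter (· ≤ w ^ 2)).exists_max_image id
      ⟨1, by simp [hn.ne', Nat.one_le_pow _ _ hw]⟩
    rw [Finset.mem_filter, Nat.mem_divisors] at hq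
    obtain ⟨⟨hqn, -⟩, hqw⟩ := hq
    obtain ⟨n', rfl⟩ := hqn
    have hq0 : 0 < q := Nat.pos_of_mul_pos_right hn
    have hn0 : 0 < n' := Nat.pos_of_mul_pos_left hn
    rcases le_or_gt w q with hwq | hwq
    · have hle : n' ≤ w ^ j := by
        by_contra! hlt
        have : w ^ (j + 1) < q * n' := by
          rw [pow_succ']
          calc w * w ^ j ≤ q * w ^ j := by gcongr
            _ < q * n' := Nat.mul_lt_mul_of_pos_left hlt hq0
        omega
      obtain ⟨q', hq'n, hq'w, hq'⟩ := ih n' hn0 hle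
      rcases le_total q.divisors.card q'.divisors.card with h | h
      · refine ⟨q', hq'n.mul_left q, hq'w, ?_⟩
        calc _ ≤ q.divisors.card * n'.divisors.card := card_divisors_mul_le _ _
          _ ≤ q'.divisors.card * (2 ^ j * q'.divisors.card ^ j) := Nat.mul_le_mul h hq'
          _ = 2 ^ j * q'.divisors.card ^ (j + 1) := by ring
          _ ≤ _ := by gcongr <;> omega
      · refine ⟨q, dvd_mul_right _ _, hqw, ?_⟩
        calc _ ≤ q.divisors.card * n'.divisors.card := card_divisors_mul_le _ _
          _ ≤ q.divisors.card * (2 ^ j * q.divisors.card ^ j) :=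
            Nat.mul_le_mul_left _ (hq'.trans (by gcongr))
          _ = 2 ^ j * q.divisors.card ^ (j + 1) := by ring
          _ ≤ _ := by gcongr <;> omega
    · refine ⟨q, dvd_mul_right _ _, hqw, ?_⟩
      have h1 := card_divisors_le_two_pow (w := w) (j + 1) n' hn0
        ((Nat.le_mul_of_pos_left _ hq0).trans hnw) (by
          intro p hp hpn
          by_contra! hpw
          have := hmax (q * p) (by
            rw [Finset.mem_filter, Nat.mem_divisors]
            exact ⟨⟨mul_dvd_mul_left q hpn, hn.ne'⟩, by
              rw [sq]; exact Nat.mul_le_mul hwq.le hpw⟩)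
          simp only [id] at this
          nlinarith [hp.two_le])
      calc _ ≤ q.divisors.card * n'.divisors.card := card_divisors_mul_le _ _
        _ ≤ q.divisors.card ^ (j + 1) * 2 ^ (j + 1) :=
          Nat.mul_le_mul (Nat.le_self_pow (by omega) _) h1
        _ = _ := mul_comm _ _

lemma two_pow_card_primeFactors_le {n : ℕ} (hn : n ≠ 0) :
    2 ^ n.primeFactors.card ≤ n.divisors.card := by
  rw [Nat.card_divisors hn]
  refine Finset.pow_card_le_prod _ _ _ fun p hp => ?_
  have := (Nat.prime_of_mem_primeFactors hp).factorization_pos_of_dvd hn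
    (Nat.dvd_of_mem_primeFactors hp)
  omega

/-- Moments of the divisor function with weight `1 / s`. -/
lemma sum_card_divisors_pow_div_le (M B : ℕ) :
    ∑ s ∈ Finset.Icc 1 M, (s.divisors.card : ℝ) ^ B / s ≤
      (∑ s ∈ Finset.Icc 1 M, (1 : ℝ) / s) ^ 2 ^ B := by
  induction B with
  | zero => simp
  | succ B ih =>
    have hnn : 0 ≤ ∑ s ∈ Finset.Icc 1 M, (s.divisors.card : ℝ) ^ B / s :=
      Finset.sum_nonneg fun _ _ => by positivity
    rw [pow_succ 2, pow_mul]
    refine le_trans ?_ (pow_le_pow_left₀ hnn ih 2)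
    -- One factor `τ(s)` is spent as the number of factorisations `s = x y`, and `τ(s) ≤ τ(x) τ(y)`
    -- splits the rest. Dropping `x y ≤ M` leaves the square of the previous sum.
    let g : ℕ × ℕ → ℝ := fun x =>
      ((x.1.divisors.card : ℝ) ^ B / x.1) * ((x.2.divisors.card : ℝ) ^ B / x.2)
    have hg : ∀ x, 0 ≤ g x := fun x => by positivity
    calc _ ≤ ∑ s ∈ Finset.Icc 1 M, ∑ x ∈ Finset.Icc 1 M ×ˢ Finset.Icc 1 M,
          if x.1 * x.2 = s then g x else 0 := by
          refine Finset.sum_le_sum fun s hs => ?_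
          rw [Finset.mem_Icc] at hs
          rw [← Finset.sum_filter]
          calc (s.divisors.card : ℝ) ^ (B + 1) / s
              = ∑ x ∈ s.divisorsAntidiagonal, (s.divisors.card : ℝ) ^ B / s := by
                rw [Finset.sum_const, ← Nat.map_div_right_divisors, Finset.card_map, nsmul_eq_mul]
                ring
            _ ≤ ∑ x ∈ s.divisorsAntidiagonal, g x := by
              refine Finset.sum_le_sum fun x hx => ?_
              have hx1 := (Nat.mem_divisorsAntidiagonal.mp hx).1
              simp only [g]
              rw [div_mul_div_comm, ← mul_pow, ← hx1]
              push_cast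
              gcongr
              exact_mod_cast card_divisors_mul_le _ _
            _ ≤ _ := by
              refine Finset.sum_le_sum_of_subset_of_nonneg (fun x hx => ?_) fun x _ _ => hg x
              obtain ⟨hx1, hx2⟩ := Nat.mem_divisorsAntidiagonal.mp hx
              have h1 : 0 < x.1 := Nat.pos_of_ne_zero (by rintro h; simp [h] at hx1; omega)
              have h2 : 0 < x.2 := Nat.pos_of_ne_zero (by rintro h; simp [h] at hx1; omega)
              simp only [Finset.mem_filter, Finset.mem_product, Finset.mem_Icc]
              refine ⟨⟨⟨h1, ?_⟩, h2, ?_⟩, hx1⟩ <;> nlinarith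
      _ = ∑ x ∈ Finset.Icc 1 M ×ˢ Finset.Icc 1 M, ∑ s ∈ Finset.Icc 1 M,
          if x.1 * x.2 = s then g x else 0 := Finset.sum_comm
      _ ≤ ∑ x ∈ Finset.Icc 1 M ×ˢ Finset.Icc 1 M, g x := by
          refine Finset.sum_le_sum fun x _ => ?_
          rw [Finset.sum_ite_eq]
          split_ifs
          · exact le_rfl
          · exact hg x
      _ = _ := by rw [sq, Finset.sum_mul_sum, Finset.sum_product]

lemma sum_Icc_one_div_le (M : ℕ) : ∑ s ∈ Finset.Icc 1 M, (1 : ℝ) / s ≤ 1 + Real.log M := by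
  have := harmonic_le_one_add_log M
  rw [harmonic_eq_sum_Icc] at this
  simpa using this

end DivisorBounds

/-! ### Roots of monic polynomials modulo prime powers. -/

section PolynomialCongruences
open Polynomial

/-- Among `deg Q + 1` solutions of `Q ≡ 0 (mod p ^ a)`, `Q` monic, some two are congruent modulo a
large power of `p`. -/
lemma exists_pow_dvd_sub {p : ℕ} (hp : p.Prime) {Q : ℤ[X]} (hQ : Q.Monic) {a b : ℕ}
    (hab : Q.natDegree * b < a) {s : Finset ℤ} (hs : s.card = Q.natDegree + 1)
    (h : ∀ n ∈ s, (p : ℤ) ^ a ∣ Q.eval n) :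
    ∃ m ∈ s, ∃ n ∈ s, m ≠ n ∧ (p : ℤ) ^ (b + 1) ∣ m - n := by
  by_contra! hcon
  have : Fact p.Prime := ⟨hp⟩
  have hp1 : (1 : ℚ) < p := by exact_mod_cast hp.one_lt
  have hp0 : (0 : ℚ) < p := by linarith
  have hmap : (Q.map (Int.castRingHom ℚ)).Monic := hQ.map _
  -- Interpolation writes the leading coefficient `1` as `∑ Q(i) / ∏ (i - j)`. If no two points
  -- agreed modulo `p ^ (b + 1)`, each term would have `p`-adic norm at most `p ^ (b deg Q - a) <
  -- 1`, and so the sum would have norm below `1`.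
  have h1 := Lagrange.leadingCoeff_eq_sum (s := s) (v := fun n : ℤ => (n : ℚ))
    Int.cast_injective.injOn (P := Q.map (Int.castRingHom ℚ)) (by
      rw [hQ.degree_map, degree_eq_natDegree hQ.ne_zero, hs]; rfl)
  rw [hmap.leadingCoeff] at h1
  have h2 : padicNorm p (∑ i ∈ s, ((Q.map (Int.castRingHom ℚ)).eval (i : ℚ)) /
      ∏ j ∈ s.erase i, ((i : ℚ) - j)) < 1 := by
    refine padicNorm.sum_lt' (fun i hi => ?_) one_pos
    rw [padicNorm.div]
    have hnum : padicNorm p ((Q.map (Int.castRingHom ℚ)).eval (i : ℚ)) ≤ (p : ℚ) ^ (-(a : ℤ)) := by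
      rw [eval_intCast_map]
      exact padicNorm.dvd_iff_norm_le.mp (by exact_mod_cast h i hi)
    have hden : ((p : ℚ) ^ (-(b : ℤ))) ^ Q.natDegree ≤
        padicNorm p (∏ j ∈ s.erase i, ((i : ℚ) - j)) := by
      have hc : (s.erase i).card = Q.natDegree := by
        rw [Finset.card_erase_of_mem hi, hs]; rfl
      have hprod : padicNorm p (∏ j ∈ s.erase i, ((i : ℚ) - j)) =
          ∏ j ∈ s.erase i, padicNorm p ((i : ℚ) - j) := by
        generalize s.erase i = u
        induction u using Finset.induction_on with
        | empty => simp
        | insert x u hx ih => rw [Finset.prod_insert hx, Finset.prod_insert hx, padicNorm.mul, ih]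
      rw [hprod, ← hc, ← Finset.prod_const]
      refine Finset.prod_le_prod (fun _ _ => by positivity) fun j hj => ?_
      have hj1 := Finset.mem_erase.mp hj
      have hnd := hcon i hi j hj1.2 hj1.1.symm
      have hne : (i : ℚ) - j ≠ 0 := by
        rw [sub_ne_zero]; exact_mod_cast hj1.1.symm
      obtain ⟨z, hz⟩ := padicNorm.values_discrete (p := p) hne
      rw [hz]
      rw [show (p : ℤ) ^ (b + 1) = ((p ^ (b + 1) : ℕ) : ℤ) by push_cast; rfl,
        padicNorm.dvd_iff_norm_le] at hnd
      push Not at hnd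
      rw [show ((i - j : ℤ) : ℚ) = (i : ℚ) - j by push_cast; rfl, hz,
        zpow_lt_zpow_iff_right₀ hp1] at hnd
      rw [zpow_le_zpow_iff_right₀ hp1]
      push_cast at hnd
      omega
    have hden0 : (0 : ℚ) < ((p : ℚ) ^ (-(b : ℤ))) ^ Q.natDegree := by positivity
    rw [div_lt_one (hden0.trans_le hden)]
    refine (hnum.trans_lt ?_).trans_le hden
    rw [← zpow_natCast, ← zpow_mul, zpow_lt_zpow_iff_right₀ hp1]
    have : ((Q.natDegree * b : ℕ) : ℤ) < a := by exact_mod_cast hab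
    push_cast at this
    linarith
  rw [← h1, padicNorm.one] at h2
  exact lt_irrefl _ h2

lemma card_image_emod_le {p : ℕ} (hp : p.Prime) {Q : ℤ[X]} (hQ : Q.Monic) {a b : ℕ}
    (hab : Q.natDegree * b < a) {s : Finset ℤ} (h : ∀ n ∈ s, (p : ℤ) ^ a ∣ Q.eval n) :
    (s.image fun n => n % (p : ℤ) ^ (b + 1)).card ≤ Q.natDegree := by
  by_contra! hlt
  obtain ⟨t, ht, htc⟩ := Finset.exists_subset_card_eq hlt
  obtain ⟨u, hus, huinj, hut⟩ := Finset.exists_subset_injOn_image_eq_of_surjOn (s : Set ℤ) t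
    (f := fun n => n % (p : ℤ) ^ (b + 1)) (fun x hx => by
      obtain ⟨y, hy, hyx⟩ := Finset.mem_image.mp (ht hx)
      exact ⟨y, hy, hyx⟩)
  have huc : u.card = Q.natDegree + 1 := by
    rw [← Nat.succ_eq_add_one, ← htc, ← hut, Finset.card_image_of_injOn huinj]
  obtain ⟨m, hm, n, hn, hmn, hd⟩ := exists_pow_dvd_sub hp hQ hab huc
    fun n hn => h n (hus hn)
  exact hmn (huinj hm hn (Int.emod_eq_emod_iff_emod_sub_eq_zero.mpr
    (Int.emod_eq_zero_of_dvd hd)))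

end PolynomialCongruences

/-- The product of the prime powers `p ^ ⌈v_p(q) / D⌉`. -/
def ceilRoot (D q : ℕ) : ℕ := ∏ p ∈ q.primeFactors, p ^ ((q.factorization p - 1) / D + 1)

section CeilRoot

lemma ceilRoot_pos (D q : ℕ) : 0 < ceilRoot D q :=
  Finset.prod_pos fun _ hp => pow_pos (Nat.prime_of_mem_primeFactors hp).pos _

lemma factorization_pos_of_mem {p q : ℕ} (hp : p ∈ q.primeFactors) : 0 < q.factorization p :=
  (Nat.prime_of_mem_primeFactors hp).factorization_pos_of_dvd (Nat.mem_primeFactors.mp hp).2.2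
    (Nat.dvd_of_mem_primeFactors hp)

lemma prod_primeFactors_pow {q : ℕ} (hq : q ≠ 0) :
    ∏ p ∈ q.primeFactors, p ^ q.factorization p = q :=
  Nat.prod_factorization_pow_eq_self hq

lemma ceilRoot_dvd (D : ℕ) {q : ℕ} (hq : q ≠ 0) : ceilRoot D q ∣ q := by
  conv_rhs => rw [← prod_primeFactors_pow hq]
  refine Finset.prod_dvd_prod_of_dvd _ _ fun p hp => pow_dvd_pow p ?_
  have h1 := factorization_pos_of_mem hp
  have h2 := Nat.div_le_self (q.factorization p - 1) D
  omega

lemma dvd_ceilRoot_pow {D : ℕ} (hD : 0 < D) {q : ℕ} (hq : q ≠ 0) : q ∣ ceilRoot D q ^ D := by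
  conv_lhs => rw [← prod_primeFactors_pow hq]
  rw [ceilRoot, ← Finset.prod_pow]
  refine Finset.prod_dvd_prod_of_dvd _ _ fun p _ => ?_
  rw [← pow_mul]
  refine pow_dvd_pow p ?_
  have h1 := Nat.lt_div_mul_add hD (a := q.factorization p - 1)
  rw [add_mul, one_mul]
  omega

lemma ceilRoot_dvd_of_forall {D q : ℕ} {z : ℤ}
    (h : ∀ p ∈ q.primeFactors, (p : ℤ) ^ ((q.factorization p - 1) / D + 1) ∣ z) :
    (ceilRoot D q : ℤ) ∣ z := by
  rw [ceilRoot]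
  push_cast
  refine Finset.prod_dvd_of_coprime (fun p hp p' hp' hne => ?_) h
  exact (Nat.Coprime.isCoprime ((Nat.coprime_primes (Nat.prime_of_mem_primeFactors hp)
    (Nat.prime_of_mem_primeFactors hp')).mpr hne)).pow

end CeilRoot

/-! ### Mean values of the divisor function along a polynomial. -/

section CountSolutions
open Polynomial

lemma card_filter_emod_eq_le (M r : ℕ) (hr : 0 < r) (v : ℤ) :
    (((Finset.Icc (-(M : ℤ)) M).filter fun n => (r : ℤ) ∣ n - v).card : ℝ) ≤
      (2 * M + 1) / r + 1 := by
  have h1 := Int.Ioc_filter_modEq_card (-(M : ℤ) - 1) M (r := r) (by exact_mod_cast hr) v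
  have h2 : ((Finset.Icc (-(M : ℤ)) M).filter fun n => (r : ℤ) ∣ n - v) =
      (Finset.Ioc (-(M : ℤ) - 1) M).filter fun n => n ≡ v [ZMOD r] := by
    ext n
    simp only [Finset.mem_filter, Finset.mem_Icc, Finset.mem_Ioc]
    constructor
    · rintro ⟨⟨h3, h4⟩, h5⟩
      exact ⟨⟨by omega, h4⟩, (Int.modEq_iff_dvd.mpr h5).symm⟩
    · rintro ⟨⟨h3, h4⟩, h5⟩
      exact ⟨⟨by omega, h4⟩, Int.modEq_iff_dvd.mp h5.symm⟩
  rw [h2]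
  have hr' : (0 : ℚ) < r := by exact_mod_cast hr
  have h3 : (((Finset.Ioc (-(M : ℤ) - 1) M).filter fun n => n ≡ v [ZMOD r]).card : ℚ) ≤
      (2 * M + 1) / r + 1 := by
    have h4 : (((Finset.Ioc (-(M : ℤ) - 1) M).filter fun n => n ≡ v [ZMOD r]).card : ℚ) =
        (((Finset.Ioc (-(M : ℤ) - 1) M).filter fun n => n ≡ v [ZMOD r]).card : ℤ) := by
      push_cast; rfl
    rw [h4, h1]
    push_cast
    refine max_le ?_ (by positivity)
    have h5 := Int.floor_le (((M : ℚ) - v) / r)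
    have h6 := Int.lt_floor_add_one (((-(M : ℚ) - 1) - v) / r)
    have h7 : ((M : ℚ) - v) / r - ((-(M : ℚ) - 1) - v) / r = (2 * M + 1) / r := by
      rw [← sub_div]; congr 1; ring
    linarith
  have h4 := (Rat.cast_le (K := ℝ)).mpr h3
  push_cast at h4
  exact h4

/-- The number of solutions of `Q ≡ 0 (mod q)` in an interval, for `Q` monic. -/
lemma card_filter_dvd_eval_le {Q : ℤ[X]} (hQ : Q.Monic) {M q : ℕ}
    (hq : 0 < q) (hqM : q ≤ M) :
    (((Finset.Icc (-(M : ℤ)) M).filter fun n => (q : ℤ) ∣ Q.eval n).card : ℝ) ≤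
      (Q.natDegree : ℝ) ^ q.primeFactors.card * (4 * M / ceilRoot Q.natDegree q) := by
  classical
  set D := Q.natDegree
  set r := ceilRoot D q with hr
  have hr0 : 0 < r := ceilRoot_pos D q
  set S := (Finset.Icc (-(M : ℤ)) M).filter fun n => (q : ℤ) ∣ Q.eval n with hS
  let b : ℕ → ℕ := fun p => (q.factorization p - 1) / D
  -- `φ` takes at most `D` values at each prime of `q`, and its value fixes `n` modulo `r` by
  -- coprimality.
  let φ : ℤ → (∀ p ∈ q.primeFactors, ℤ) := fun n p _ => n % (p : ℤ) ^ (b p + 1)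
  have himg : (S.image φ).card ≤ D ^ q.primeFactors.card := by
    calc _ ≤ (q.primeFactors.pi fun p => S.image fun n => n % (p : ℤ) ^ (b p + 1)).card := by
          refine Finset.card_le_card fun x hx => ?_
          obtain ⟨n, hn, rfl⟩ := Finset.mem_image.mp hx
          exact Finset.mem_pi.mpr fun p _ => Finset.mem_image_of_mem _ hn
      _ = ∏ p ∈ q.primeFactors, (S.image fun n => n % (p : ℤ) ^ (b p + 1)).card :=
          Finset.card_pi _ _
      _ ≤ ∏ p ∈ q.primeFactors, D := by
          refine Finset.prod_le_prod' fun p hp => ?_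
          refine card_image_emod_le (Nat.prime_of_mem_primeFactors hp) hQ
            (a := q.factorization p) ?_ fun n hn => ?_
          · have h1 := factorization_pos_of_mem hp
            have h2 := Nat.mul_div_le (q.factorization p - 1) D
            change D * ((q.factorization p - 1) / D) < _
            omega
          · refine dvd_trans ?_ (Finset.mem_filter.mp hn).2
            exact_mod_cast Nat.ordProj_dvd q p
      _ = _ := by simp
  have hfib : ∀ x ∈ S.image φ, ((S.filter fun n => φ n = x).card : ℝ) ≤ 4 * M / r := by
    intro x hx
    obtain ⟨v, -, rfl⟩ := Finset.mem_image.mp hx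
    have hsub : (S.filter fun n => φ n = φ v) ⊆
        (Finset.Icc (-(M : ℤ)) M).filter fun n => (r : ℤ) ∣ n - v := by
      intro n hn
      simp only [hS, Finset.mem_filter] at hn ⊢
      refine ⟨hn.1.1, ceilRoot_dvd_of_forall fun p hp => ?_⟩
      have := congrFun (congrFun hn.2 p) hp
      exact Int.dvd_of_emod_eq_zero (Int.emod_eq_emod_iff_emod_sub_eq_zero.mp this)
    have h1 : ((S.filter fun n => φ n = φ v).card : ℝ) ≤ _ :=
      Nat.cast_le.mpr (Finset.card_le_card hsub)
    refine h1.trans ((card_filter_emod_eq_le M r hr0 v).trans ?_)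
    have hr' : (0 : ℝ) < r := by exact_mod_cast hr0
    have hrq : r ≤ q := Nat.le_of_dvd hq (ceilRoot_dvd D hq.ne')
    have hrM : (r : ℝ) ≤ M := by exact_mod_cast hrq.trans hqM
    have hM1 : (1 : ℝ) ≤ M := by exact_mod_cast (show 1 ≤ M by omega)
    -- From `r ≤ M` and `1 ≤ M`: `2 M + 1 + r ≤ 4 M`.
    rw [div_add_one hr'.ne', div_le_div_iff_of_pos_right hr']
    linarith
  calc (S.card : ℝ) = ∑ x ∈ S.image φ, ((S.filter fun n => φ n = x).card : ℝ) := by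
        rw [Finset.card_eq_sum_card_image φ S]; push_cast; rfl
    _ ≤ ∑ x ∈ S.image φ, 4 * (M : ℝ) / r := Finset.sum_le_sum hfib
    _ = (S.image φ).card * (4 * M / r) := by rw [Finset.sum_const, nsmul_eq_mul]
    _ ≤ _ := by
      gcongr
      exact_mod_cast himg

/-- Group the `q` by `s = ceilRoot D q`. Since `q ∣ s ^ D`, both `τ(q)` and `D ^ ω(q)` are at most
powers of `τ(s)`, and a fibre has at most `τ(s) ^ D` elements. -/
lemma sum_card_divisors_pow_mul_le (D j M : ℕ) (hD : 0 < D) :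
    ∑ q ∈ Finset.Icc 1 M, (q.divisors.card : ℝ) ^ j *
      ((D : ℝ) ^ q.primeFactors.card * (4 * M / ceilRoot D q)) ≤
    4 * M * ∑ s ∈ Finset.Icc 1 M, (s.divisors.card : ℝ) ^ (D * j + D * D + D) / s := by
  classical
  have hterm : ∀ q ∈ Finset.Icc 1 M, (q.divisors.card : ℝ) ^ j *
      ((D : ℝ) ^ q.primeFactors.card * (4 * M / ceilRoot D q)) ≤
      4 * M * (((ceilRoot D q).divisors.card : ℝ) ^ (D * j + D * D) / ceilRoot D q) := by
    intro q hq
    have hq0 : q ≠ 0 := by have := (Finset.mem_Icc.mp hq).1; omega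
    have h1 : q.divisors.card ≤ (ceilRoot D q).divisors.card ^ D :=
      (card_divisors_le_of_dvd (dvd_ceilRoot_pow hD hq0)
        (pow_ne_zero _ (ceilRoot_pos D q).ne')).trans (card_divisors_pow_le _ _)
    have h2 : D ^ q.primeFactors.card ≤ (ceilRoot D q).divisors.card ^ (D * D) := by
      calc D ^ q.primeFactors.card ≤ (2 ^ D) ^ q.primeFactors.card :=
            Nat.pow_le_pow_left Nat.lt_two_pow_self.le _
        _ = (2 ^ q.primeFactors.card) ^ D := by rw [← pow_mul, ← pow_mul, mul_comm]
        _ ≤ ((ceilRoot D q).divisors.card ^ D) ^ D :=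
          Nat.pow_le_pow_left ((two_pow_card_primeFactors_le hq0).trans h1) _
        _ = _ := by rw [← pow_mul]
    have h1' : (q.divisors.card : ℝ) ≤ ((ceilRoot D q).divisors.card : ℝ) ^ D := by
      exact_mod_cast h1
    have h2' : (D : ℝ) ^ q.primeFactors.card ≤
        ((ceilRoot D q).divisors.card : ℝ) ^ (D * D) := by exact_mod_cast h2
    calc _ ≤ (((ceilRoot D q).divisors.card : ℝ) ^ D) ^ j *
          (((ceilRoot D q).divisors.card : ℝ) ^ (D * D) * (4 * M / ceilRoot D q)) := by gcongr
      _ = _ := by rw [← pow_mul, pow_add]; ring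
  refine (Finset.sum_le_sum hterm).trans ?_
  rw [← Finset.mul_sum]
  refine mul_le_mul_of_nonneg_left ?_ (by positivity)
  have hmaps : ∀ q ∈ Finset.Icc 1 M, ceilRoot D q ∈ Finset.Icc 1 M := fun q hq => by
    obtain ⟨h1, h2⟩ := Finset.mem_Icc.mp hq
    exact Finset.mem_Icc.mpr ⟨ceilRoot_pos D q,
      (Nat.le_of_dvd (by omega) (ceilRoot_dvd D (by omega))).trans h2⟩
  rw [← Finset.sum_fiberwise_of_maps_to hmaps]
  refine Finset.sum_le_sum fun s hs => ?_
  have hs0 : s ≠ 0 := by have := (Finset.mem_Icc.mp hs).1; omega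
  have hcard : ((Finset.Icc 1 M).filter fun q => ceilRoot D q = s).card ≤
      s.divisors.card ^ D := by
    refine le_trans (Finset.card_le_card fun q hq => ?_) (card_divisors_pow_le s D)
    obtain ⟨h1, rfl⟩ := Finset.mem_filter.mp hq
    exact Nat.mem_divisors.mpr ⟨dvd_ceilRoot_pow hD (by have := (Finset.mem_Icc.mp h1).1; omega),
      pow_ne_zero _ hs0⟩
  calc _ = ∑ q ∈ (Finset.Icc 1 M).filter fun q => ceilRoot D q = s,
        (s.divisors.card : ℝ) ^ (D * j + D * D) / s :=
        Finset.sum_congr rfl fun q hq => by rw [(Finset.mem_filter.mp hq).2]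
    _ = ((Finset.Icc 1 M).filter fun q => ceilRoot D q = s).card *
        ((s.divisors.card : ℝ) ^ (D * j + D * D) / s) := by rw [Finset.sum_const, nsmul_eq_mul]
    _ ≤ (s.divisors.card : ℝ) ^ D * ((s.divisors.card : ℝ) ^ (D * j + D * D) / s) := by
      gcongr
      exact_mod_cast hcard
    _ = _ := by rw [pow_add _ (D * j + D * D)]; ring

lemma natAbs_eval_le (Q : ℤ[X]) {M : ℕ} (hM : 1 ≤ M) {n : ℤ} (hn : n.natAbs ≤ M) :
    (Q.eval n).natAbs ≤
      (∑ i ∈ Finset.range (Q.natDegree + 1), (Q.coeff i).natAbs) * M ^ Q.natDegree := by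
  rw [eval_eq_sum_range, Finset.sum_mul]
  refine (Int.natAbs_sum_le _ _).trans (Finset.sum_le_sum fun i hi => ?_)
  rw [Int.natAbs_mul, Int.natAbs_pow]
  refine Nat.mul_le_mul_left _ ?_
  exact (Nat.pow_le_pow_left hn i).trans
    (Nat.pow_le_pow_right hM (Nat.lt_succ_iff.mp (Finset.mem_range.mp hi)))

lemma tau_eq (n : ℤ) : tau n = n.natAbs.divisors.card := rfl

/-- The mean value of the divisor function at the values of a monic polynomial is bounded by a
power of the logarithm. -/
lemma exists_sum_tau_eval_le_of_monic {Q : ℤ[X]} (hQ : Q.Monic) (hD : 0 < Q.natDegree) :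
    ∃ A B : ℕ, ∀ M : ℕ, 4 ≤ M →
      ∑ n ∈ Finset.Icc (-(M : ℤ)) M, (tau (Q.eval n) : ℝ) ≤ A * M * (1 + Real.log M) ^ B := by
  classical
  set D := Q.natDegree
  set h := ∑ i ∈ Finset.range (D + 1), (Q.coeff i).natAbs
  -- With `w = ⌊√M⌋`: `|Q(n)| ≤ h M ^ D ≤ M ^ (h + D) ≤ w ^ j`, so the small divisor is at most `w ^
  -- 2 ≤ M`.
  obtain ⟨j, hj⟩ : ∃ j, j = 4 * (h + D) := ⟨_, rfl⟩
  refine ⟨2 ^ j * 4, 2 ^ (D * j + D * D + D), fun M hM => ?_⟩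
  set w := Nat.sqrt M
  have hwM : w ^ 2 ≤ M := Nat.sqrt_le' M
  have hw2 : 2 ≤ w := Nat.le_sqrt'.mpr (by omega)
  have hMw : M ≤ w ^ 4 := by
    have : M < (w + 1) ^ 2 := Nat.lt_succ_sqrt' M
    nlinarith [sq_nonneg ((w : ℤ) ^ 2), Nat.mul_le_mul hw2 hw2]
  have hpt : ∀ n ∈ Finset.Icc (-(M : ℤ)) M, (tau (Q.eval n) : ℝ) ≤
      2 ^ j * ∑ q ∈ Finset.Icc 1 M,
        if (q : ℤ) ∣ Q.eval n then (q.divisors.card : ℝ) ^ j else 0 := by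
    intro n hn
    have hnn : ∀ q ∈ Finset.Icc 1 M,
        0 ≤ if (q : ℤ) ∣ Q.eval n then (q.divisors.card : ℝ) ^ j else 0 := fun q _ => by
      split_ifs <;> positivity
    rcases eq_or_ne (Q.eval n) 0 with h0 | h0
    · rw [h0] at hnn ⊢
      rw [tau_zero, Nat.cast_zero]
      exact mul_nonneg (by positivity) (Finset.sum_nonneg hnn)
    · have hpos : 0 < (Q.eval n).natAbs := Int.natAbs_pos.mpr h0
      have hle : (Q.eval n).natAbs ≤ w ^ j := by
        have hnM : n.natAbs ≤ M := by
          have := Finset.mem_Icc.mp hn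
          omega
        calc _ ≤ h * M ^ D := natAbs_eval_le Q (by omega) hnM
          _ ≤ M ^ h * M ^ D := by
            gcongr
            exact (Nat.lt_pow_self (by omega)).le
          _ = M ^ (h + D) := (pow_add _ _ _).symm
          _ ≤ (w ^ 4) ^ (h + D) := Nat.pow_le_pow_left hMw _
          _ = w ^ j := by rw [← pow_mul, hj]
      obtain ⟨q, hqd, hqw, hq⟩ := exists_small_divisor (by omega) j _ hpos hle
      have hq0 : 0 < q := Nat.pos_of_dvd_of_pos hqd hpos
      have hqmem : q ∈ Finset.Icc 1 M := Finset.mem_Icc.mpr ⟨hq0, hqw.trans hwM⟩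
      calc (tau (Q.eval n) : ℝ) ≤ 2 ^ j * (q.divisors.card : ℝ) ^ j := by
            rw [tau_eq]; exact_mod_cast hq
        _ ≤ _ := by
          gcongr
          refine le_trans (le_of_eq ?_) (Finset.single_le_sum hnn hqmem)
          rw [if_pos (Int.natCast_dvd.mpr hqd)]
  calc _ ≤ ∑ n ∈ Finset.Icc (-(M : ℤ)) M, 2 ^ j * ∑ q ∈ Finset.Icc 1 M,
        (if (q : ℤ) ∣ Q.eval n then (q.divisors.card : ℝ) ^ j else 0) := Finset.sum_le_sum hpt
    _ = 2 ^ j * ∑ q ∈ Finset.Icc 1 M, (q.divisors.card : ℝ) ^ j *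
        ((Finset.Icc (-(M : ℤ)) M).filter fun n => (q : ℤ) ∣ Q.eval n).card := by
      rw [← Finset.mul_sum, Finset.sum_comm]
      congr 1
      refine Finset.sum_congr rfl fun q _ => ?_
      rw [← Finset.sum_filter, Finset.sum_const, nsmul_eq_mul, mul_comm]
    _ ≤ 2 ^ j * ∑ q ∈ Finset.Icc 1 M, (q.divisors.card : ℝ) ^ j *
        ((D : ℝ) ^ q.primeFactors.card * (4 * M / ceilRoot D q)) := by
      gcongr with q hq
      obtain ⟨hq1, hq2⟩ := Finset.mem_Icc.mp hq
      exact card_filter_dvd_eval_le hQ hq1 hq2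
    _ ≤ 2 ^ j * (4 * M * (1 + Real.log M) ^ 2 ^ (D * j + D * D + D)) := by
      gcongr
      refine (sum_card_divisors_pow_mul_le D j M hD).trans ?_
      gcongr
      refine (sum_card_divisors_pow_div_le M _).trans ?_
      gcongr
      exact sum_Icc_one_div_le M
    _ = _ := by push_cast; ring

lemma one_lt_log {H : ℕ} (hH : 3 ≤ H) : 1 < Real.log 3 ∧ Real.log 3 ≤ Real.log H := by
  constructor
  · rw [Real.lt_log_iff_exp_lt (by norm_num)]
    exact Real.exp_one_lt_d9.trans (by norm_num)
  · exact Real.log_le_log (by norm_num) (by exact_mod_cast hH)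

/-- With `l` the leading coefficient and `Q` the integral normalization, `Q(l n) = l ^ (deg P - 1)
P(n)`, so `P(n)` divides a value of the monic `Q` and the range grows only by a constant factor. -/
lemma exists_sum_tau_eval_le {P : ℤ[X]} (hP : P ≠ 0) :
    ∃ A : ℝ, ∃ B : ℕ, 0 ≤ A ∧ ∀ H : ℕ, 3 ≤ H →
      ∑ n ∈ Finset.Icc (-(H : ℤ)) H, (tau (P.eval n) : ℝ) ≤ A * H * Real.log H ^ B := by
  rcases Nat.eq_zero_or_pos P.natDegree with hD | hD
  · obtain ⟨c, rfl⟩ := natDegree_eq_zero.mp hD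
    refine ⟨3 * tau c, 0, by positivity, fun H hH => ?_⟩
    have hH' : (3 : ℝ) ≤ H := by exact_mod_cast hH
    simp only [eval_C, Finset.sum_const, nsmul_eq_mul, Int.card_Icc, pow_zero, mul_one]
    have : (((H : ℤ) + 1 - -(H : ℤ)).toNat : ℝ) = 2 * H + 1 := by
      have : ((H : ℤ) + 1 - -(H : ℤ)).toNat = 2 * H + 1 := by omega
      rw [this]; push_cast; ring
    rw [this]
    have ht : (0 : ℝ) ≤ tau c := Nat.cast_nonneg _
    nlinarith
  · obtain ⟨A, B, hAB⟩ := exists_sum_tau_eval_le_of_monic (monic_integralNormalization hP)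
      (by rwa [natDegree_integralNormalization])
    set Q := P.integralNormalization
    set l := P.leadingCoeff
    have hl : l ≠ 0 := leadingCoeff_ne_zero.mpr hP
    set N := 4 * l.natAbs
    have hl1 : 1 ≤ l.natAbs := Int.natAbs_pos.mpr hl
    have hN : (1 : ℝ) ≤ N := by exact_mod_cast (show 1 ≤ N by omega)
    refine ⟨A * N * (2 + Real.log N) ^ B, B, ?_, fun H hH => ?_⟩
    · have := Real.log_nonneg hN
      positivity
    have hH0 : (0 : ℝ) < H := by exact_mod_cast (show 0 < H by omega)
    have hlog : 1 ≤ Real.log H := (one_lt_log hH).1.le.trans (one_lt_log hH).2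
    have hlogN := Real.log_nonneg hN
    have hev : ∀ n : ℤ, Q.eval (l * n) = l ^ (P.natDegree - 1) * P.eval n := fun n => by
      simpa using integralNormalization_eval₂_leadingCoeff_mul (Nat.succ_le_of_lt hD)
        (RingHom.id ℤ) n
    have hM := hAB (N * H)
      ((show 4 ≤ N by omega).trans (Nat.le_mul_of_pos_right N (by omega)))
    calc _ ≤ ∑ n ∈ Finset.Icc (-(H : ℤ)) H, (tau (Q.eval (l * n)) : ℝ) := by
          refine Finset.sum_le_sum fun n _ => ?_
          rcases eq_or_ne (P.eval n) 0 with h0 | h0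
          · simp [h0, tau_zero]
          · rw [hev, tau_eq, tau_eq, Int.natAbs_mul]
            refine Nat.cast_le.mpr (card_divisors_le_of_dvd (dvd_mul_left _ _) ?_)
            simp [h0, hl]
      _ = ∑ n ∈ (Finset.Icc (-(H : ℤ)) H).image (l * ·), (tau (Q.eval n) : ℝ) := by
          rw [Finset.sum_image fun x _ y _ hxy => mul_left_cancel₀ hl hxy]
      _ ≤ ∑ n ∈ Finset.Icc (-((N * H : ℕ) : ℤ)) (N * H : ℕ), (tau (Q.eval n) : ℝ) := by
          refine Finset.sum_le_sum_of_subset_of_nonneg (fun x hx => ?_) fun _ _ _ => by positivity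
          obtain ⟨n, hn, rfl⟩ := Finset.mem_image.mp hx
          rw [Finset.mem_Icc] at hn ⊢
          rw [← abs_le] at hn ⊢
          rw [abs_mul, Nat.cast_mul]
          have : |l| ≤ N := by
            rw [Int.abs_eq_natAbs]
            exact_mod_cast (show l.natAbs ≤ N by omega)
          exact mul_le_mul this hn (abs_nonneg _) (by positivity)
      _ ≤ _ := hM
      _ = A * N * H * (1 + Real.log N + Real.log H) ^ B := by
          push_cast
          rw [Real.log_mul (by positivity) hH0.ne']
          ring
      _ ≤ A * N * H * ((2 + Real.log N) * Real.log H) ^ B := by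
          gcongr
          nlinarith
      _ = _ := by rw [mul_pow]; ring

/-- The form of the divisor bound in which the constant is absorbed in the exponent. -/
lemma exists_log_pow_bound {P : ℤ[X]} (hP : P ≠ 0) :
    ∃ K : ℝ, ∀ H : ℕ, 3 ≤ H →
      (max 1 P.natDegree : ℕ) * ∑ n ∈ Finset.Icc (-(H : ℤ)) H, (tau (P.eval n) : ℝ) ≤
        (2 * H + 1) * Real.log H ^ K := by
  obtain ⟨A, B, hA, hAB⟩ := exists_sum_tau_eval_le hP
  -- As `log H ≥ log 3 > 1`, a power of `log H` absorbs the constant.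
  obtain ⟨b, hb⟩ := pow_unbounded_of_one_lt ((max 1 P.natDegree : ℕ) * A)
    (one_lt_log le_rfl).1
  refine ⟨((b + B : ℕ) : ℝ), fun H hH => ?_⟩
  have hl := one_lt_log hH
  have h0 : 0 < Real.log H := by linarith
  rw [Real.rpow_natCast]
  have h1 : ((max 1 P.natDegree : ℕ) * A : ℝ) ≤ Real.log H ^ b :=
    hb.le.trans (by gcongr; exact_mod_cast hH)
  calc _ ≤ ((max 1 P.natDegree : ℕ) : ℝ) * (A * H * Real.log H ^ B) := by
        gcongr; exact hAB H hH
    _ = ((max 1 P.natDegree : ℕ) * A : ℝ) * (H * Real.log H ^ B) := by ring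
    _ ≤ Real.log H ^ b * ((2 * H + 1) * Real.log H ^ B) := by
      gcongr
      linarith [Nat.cast_nonneg (α := ℝ) H]
    _ = _ := by rw [pow_add]; ring

end CountSolutions

/-! ### The bound in real numbers. -/

section RealForm

/-- A singleton has nonnegative mass, so `C ≥ 0` once `L ≥ 1`. For `L = 0` uniformity tests only the
empty set and `C` may be negative. -/
lemma Model.const_nonneg {μ : Measure Ω} {d k m L H : ℕ} {C : ℝ} {a : ℕ → Ω → ℤ}
    {t : Fin m → Ω → ℝ} {F₁ : ℕ → MvPolynomial (Fin m) ℝ}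
    {F₂ : MvPolynomial (Fin (m + 1)) ℝ} {S : Fin m → Finset ℝ} (hH : 1 ≤ H)
    (h : Model d k m L H C μ a t F₁ F₂ S) : 0 ≤ C * L := by
  rcases Nat.eq_zero_or_pos L with rfl | hL
  · simp
  refine mul_nonneg ?_ (Nat.cast_nonneg L)
  have i : Fin m := ⟨0, h.m_pos⟩
  have hcard : 0 < (S i).card := by have := h.card_le i; omega
  obtain ⟨x, -⟩ := Finset.card_pos.mp hcard
  have h1 := measureReal_nonneg.trans ((h.uniform i).2 {x} (by
    rw [Finset.card_singleton]
    exact Nat.one_le_iff_ne_zero.mpr (by positivity)))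
  rw [Finset.card_singleton, Nat.cast_one, mul_one] at h1
  by_contra! hC
  exact absurd h1 (not_le.mpr (div_neg_of_neg_of_pos hC (by exact_mod_cast hcard)))

lemma Model.le_real_irredEvent {μ : Measure Ω} [IsProbabilityMeasure μ]
    {d k m L H : ℕ} {C : ℝ} {a : ℕ → Ω → ℤ} {t : Fin m → Ω → ℝ}
    {F₁ : ℕ → MvPolynomial (Fin m) ℝ} {F₂ : MvPolynomial (Fin (m + 1)) ℝ}
    {S : Fin m → Finset ℝ} (hH : 1 ≤ H) (h : Model d k m L H C μ a t F₁ F₂ S) {J : ℝ}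
    (hJ : 0 ≤ J)
    (hI : ∫⁻ ω in {ω | a 0 ω ≠ 0}, (tau (a 0 ω) : ℝ≥0∞) ∂μ ≤ ENNReal.ofReal J) :
    1 - μ.real {ω | a 0 ω = 0} - 2 * C * m * d * 2 ^ d * L * J / H ≤
      μ.real (irredEvent d a) := by
  have h1 := h.one_le_measure_irredEvent_add hH
  have hκ : 0 ≤ 2 * C * d * m * 2 ^ d * L / H := by
    have := h.const_nonneg hH
    have h2 : 2 * C * d * m * 2 ^ d * L / H = (C * L) * (2 * d * m * 2 ^ d / H) := by ring
    rw [h2]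
    positivity
  have h2 : (1 : ℝ≥0∞) ≤ ENNReal.ofReal (μ.real (irredEvent d a) +
      2 * C * d * m * 2 ^ d * L / H * J + μ.real {ω | a 0 ω = 0}) := by
    rw [ENNReal.ofReal_add (by positivity) measureReal_nonneg,
      ENNReal.ofReal_add measureReal_nonneg (by positivity), ofReal_measureReal,
      ofReal_measureReal, ENNReal.ofReal_mul hκ]
    refine h1.trans ?_
    gcongr
  rw [ENNReal.one_le_ofReal] at h2
  have h3 : 2 * C * m * d * 2 ^ d * L * J / H = 2 * C * d * m * 2 ^ d * L / H * J := by ring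
  rw [h3]
  linarith

end RealForm

/-! ### Constant terms distributed on polynomial values. -/

section ValueDistributions
open Polynomial

lemma card_filter_eval_eq_le {P : ℤ[X]} {v : ℤ} (hv : P - C v ≠ 0) (s : Finset ℤ) :
    (s.filter fun n => P.eval n = v).card ≤ P.natDegree := by
  rw [← natDegree_sub_C (a := v)]
  refine le_trans (Finset.card_le_card fun n hn => ?_)
    ((Multiset.toFinset_card_le _).trans (card_roots' (P - C v)))
  rw [Multiset.mem_toFinset, mem_roots hv, IsRoot, eval_sub, eval_C,
    (Finset.mem_filter.mp hn).2, sub_self]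

lemma sub_C_ne_zero_of_natDegree_pos {P : ℤ[X]} (hP : 0 < P.natDegree) (v : ℤ) :
    P - C v ≠ 0 := by
  intro h
  rw [sub_eq_zero.mp h, natDegree_C] at hP
  exact lt_irrefl _ hP

lemma card_Icc_neg_self (H : ℕ) : (Finset.Icc (-(H : ℤ)) H).card = 2 * H + 1 := by
  rw [Int.card_Icc]; omega

/-- The prescribed masses on the value set already add up to `1`. -/
lemma UniformOnValueSet.measureReal_eq_zero {μ : Measure Ω} [IsProbabilityMeasure μ] {X : Ω → ℤ}
    (hX : Measurable X) {P : ℤ[X]} {H : ℕ} (h : UniformOnValueSet μ X P H) {v : ℤ}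
    (hv : v ∉ (Finset.Icc (-(H : ℤ)) H).image fun n => P.eval n) :
    μ.real {ω | X ω = v} = 0 := by
  set V := (Finset.Icc (-(H : ℤ)) H).image fun n => P.eval n
  have hV : (0 : ℝ) < V.card := by
    have : V.Nonempty := Finset.Nonempty.image ⟨0, by simp⟩ _
    exact_mod_cast Finset.card_pos.mpr this
  have hm : ∀ w : ℤ, MeasurableSet {ω | X ω = w} := fun w => hX (measurableSet_singleton w)
  have h1 : μ.real (⋃ w ∈ insert v V, {ω | X ω = w}) ≤ 1 := measureReal_le_one
  rw [measureReal_biUnion_finset (fun w _ w' _ hne => Set.disjoint_left.mpr fun ω h1 h2 =>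
    hne (h1.symm.trans h2)) fun w _ => hm w, Finset.sum_insert hv, Finset.sum_congr rfl h,
    Finset.sum_const, nsmul_eq_mul, mul_one_div_cancel hV.ne'] at h1
  exact le_antisymm (by linarith) measureReal_nonneg

lemma le_card_image_eval_mul {P : ℤ[X]} (hP : 0 < P.natDegree) (H : ℕ) :
    2 * H + 1 ≤ P.natDegree * ((Finset.Icc (-(H : ℤ)) H).image fun n => P.eval n).card := by
  rw [← card_Icc_neg_self]
  exact Finset.card_le_mul_card_image _ _ fun v _ =>
    card_filter_eval_eq_le (sub_C_ne_zero_of_natDegree_pos hP v) _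

/-- A nonconstant `P` takes each value at most `deg P` times, so the value set has at least `(2 H +
1) / deg P` elements. This puts both distributions under one bound; the maximum with `1` covers
constant `P` and the list version. -/
lemma measureReal_value_le {μ : Measure Ω} [IsProbabilityMeasure μ] {X : Ω → ℤ}
    (hX : Measurable X) {P : ℤ[X]} {H : ℕ}
    (h : UniformOnValueSet μ X P H ∨ UniformOnValueList μ X P H) (v : ℤ) :
    μ.real {ω | X ω = v} ≤ (max 1 P.natDegree : ℕ) *
      ((Finset.Icc (-(H : ℤ)) H).filter fun n => P.eval n = v).card / (2 * H + 1) := by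
  have hN : (0 : ℝ) < 2 * H + 1 := by positivity
  rcases h with h | h
  · by_cases hv : v ∈ (Finset.Icc (-(H : ℤ)) H).image fun n => P.eval n
    · rcases Nat.eq_zero_or_pos P.natDegree with hD | hD
      · obtain ⟨c, rfl⟩ := natDegree_eq_zero.mp hD
        simp only [eval_C, Finset.mem_image] at hv
        obtain ⟨-, -, rfl⟩ := hv
        simp only [eval_C, Finset.filter_true, card_Icc_neg_self, natDegree_C]
        refine measureReal_le_one.trans ?_
        push_cast
        rw [max_eq_left zero_le_one, one_mul, div_self hN.ne']
      · rw [h v hv]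
        set V := (Finset.Icc (-(H : ℤ)) H).image fun n => P.eval n
        have hV : (0 : ℝ) < V.card := by exact_mod_cast Finset.card_pos.mpr ⟨v, hv⟩
        have h1 : (2 * H + 1 : ℝ) ≤ P.natDegree * V.card := by
          exact_mod_cast le_card_image_eval_mul hD H
        obtain ⟨n, hn, hnv⟩ := Finset.mem_image.mp hv
        have h2 : (1 : ℝ) ≤ ((Finset.Icc (-(H : ℤ)) H).filter fun n => P.eval n = v).card := by
          exact_mod_cast Finset.card_pos.mpr ⟨n, Finset.mem_filter.mpr ⟨hn, hnv⟩⟩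
        rw [max_eq_right (Nat.succ_le_of_lt hD), div_le_div_iff₀ hV hN, one_mul]
        refine h1.trans ?_
        gcongr
        exact le_mul_of_one_le_right (Nat.cast_nonneg _) h2
    · rw [h.measureReal_eq_zero hX hv]
      positivity
  · rw [h v]
    gcongr
    refine le_mul_of_one_le_left (Nat.cast_nonneg _) ?_
    exact_mod_cast le_max_left 1 P.natDegree

lemma measureReal_zero_le {μ : Measure Ω} [IsProbabilityMeasure μ] {X : Ω → ℤ}
    (hX : Measurable X) {P : ℤ[X]} (hP : P ≠ 0) {H : ℕ}
    (h : UniformOnValueSet μ X P H ∨ UniformOnValueList μ X P H) :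
    μ.real {ω | X ω = 0} ≤ P.natDegree / (2 * H + 1) := by
  have hN : (0 : ℝ) < 2 * H + 1 := by positivity
  rcases h with h | h
  · by_cases hv : (0 : ℤ) ∈ (Finset.Icc (-(H : ℤ)) H).image fun n => P.eval n
    · rw [h 0 hv]
      have hD : 0 < P.natDegree := by
        by_contra! hD
        obtain ⟨c, rfl⟩ := natDegree_eq_zero.mp (Nat.le_zero.mp hD)
        obtain ⟨n, -, hn⟩ := Finset.mem_image.mp hv
        simp at hn
        simp [hn] at hP
      have hV : (0 : ℝ) < ((Finset.Icc (-(H : ℤ)) H).image fun n => P.eval n).card := by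
        exact_mod_cast Finset.card_pos.mpr ⟨0, hv⟩
      rw [div_le_div_iff₀ hV hN, one_mul]
      exact_mod_cast le_card_image_eval_mul hD H
    · rw [h.measureReal_eq_zero hX hv]
      positivity
  · rw [h 0]
    gcongr
    exact card_filter_eval_eq_le (by simpa using hP) _

lemma setLIntegral_tau_le {μ : Measure Ω} [IsProbabilityMeasure μ] {X : Ω → ℤ}
    (hX : Measurable X) {P : ℤ[X]} {H : ℕ}
    (h : UniformOnValueSet μ X P H ∨ UniformOnValueList μ X P H) :
    ∫⁻ ω in {ω | X ω ≠ 0}, (tau (X ω) : ℝ≥0∞) ∂μ ≤ ENNReal.ofReal ((max 1 P.natDegree : ℕ) *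
      (∑ n ∈ Finset.Icc (-(H : ℤ)) H, (tau (P.eval n) : ℝ)) / (2 * H + 1)) := by
  set V := (Finset.Icc (-(H : ℤ)) H).image fun n => P.eval n with hV
  let g : ℤ → ℝ := fun c => tau c * ((max 1 P.natDegree : ℕ) *
      ((Finset.Icc (-(H : ℤ)) H).filter fun n => P.eval n = c).card / (2 * H + 1))
  have hg : ∀ c, 0 ≤ g c := fun c => by positivity
  calc _ = ∑' c : ℤ, (tau c : ℝ≥0∞) * μ {ω | X ω = c} := setLIntegral_tau hX
    _ ≤ ∑' c : ℤ, ENNReal.ofReal (g c) := by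
      refine ENNReal.tsum_le_tsum fun c => ?_
      rw [ENNReal.ofReal_mul (Nat.cast_nonneg _), ENNReal.ofReal_natCast, ← ofReal_measureReal]
      gcongr
      exact measureReal_value_le hX h c
    _ = ∑ c ∈ V, ENNReal.ofReal (g c) := by
      refine tsum_eq_sum fun c hc => ?_
      have : ((Finset.Icc (-(H : ℤ)) H).filter fun n => P.eval n = c) = ∅ :=
        Finset.filter_eq_empty_iff.mpr fun n hn hnc => hc (Finset.mem_image.mpr ⟨n, hn, hnc⟩)
      simp only [g]
      rw [this]
      simp
    _ = ENNReal.ofReal (∑ c ∈ V, g c) := (ENNReal.ofReal_sum_of_nonneg fun c _ => hg c).symm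
    _ = _ := by
      rw [Finset.sum_comp (fun c => (tau c : ℝ)) (fun n => P.eval n), Finset.mul_sum,
        Finset.sum_div]
      congr 1
      refine Finset.sum_congr rfl fun c _ => ?_
      simp only [g, nsmul_eq_mul]
      ring

end ValueDistributions

lemma setLIntegral_tau_le_of_isSimple {μ : Measure Ω} [IsProbabilityMeasure μ] {X : Ω → ℤ}
    {s : ℝ} (h : ∀ᵐ ω ∂μ, IsSimple s (X ω).natAbs) :
    ∫⁻ ω in {ω | X ω ≠ 0}, (tau (X ω) : ℝ≥0∞) ∂μ ≤ ENNReal.ofReal s := by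
  calc _ ≤ ∫⁻ ω, (tau (X ω) : ℝ≥0∞) ∂μ := setLIntegral_le_lintegral _ _
    _ ≤ ∫⁻ _, ENNReal.ofReal s ∂μ := by
      refine lintegral_mono_ae ?_
      filter_upwards [h] with ω hω
      rw [← ENNReal.ofReal_natCast]
      refine ENNReal.ofReal_le_ofReal ?_
      simpa only [tau, Int.natAbs_natCast] using hω.2
    _ = _ := by simp

end RandomPoly

theorem theorem1p4 :
    -- the general bound, in `[0, ∞]` with truncated subtraction, as the expectation may be infinite
    (∀ (Ω : Type u) [MeasurableSpace Ω] (μ : Measure Ω) [IsProbabilityMeasure μ]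
        (d k m L H : ℕ) (C : ℝ) (a : ℕ → Ω → ℤ) (t : Fin m → Ω → ℝ)
        (F₁ : ℕ → MvPolynomial (Fin m) ℝ) (F₂ : MvPolynomial (Fin (m + 1)) ℝ)
        (S : Fin m → Finset ℝ),
        1 ≤ H → RandomPoly.Model d k m L H C μ a t F₁ F₂ S →
        1 - μ {ω | a 0 ω = 0} -
            ENNReal.ofReal (2 * C * d * m * 2 ^ d * L / H) *
              ∫⁻ ω in {ω | a 0 ω ≠ 0}, (RandomPoly.tau (a 0 ω) : ℝ≥0∞) ∂μ
          ≤ μ (RandomPoly.irredEvent d a)) ∧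
    -- constant coefficient uniform on polynomial values
    (∀ P : ℤ[X], P ≠ 0 → ∃ K : ℝ,
      ∀ (Ω : Type u) [MeasurableSpace Ω] (μ : Measure Ω) [IsProbabilityMeasure μ]
        (d k m L H : ℕ) (C : ℝ) (a : ℕ → Ω → ℤ) (t : Fin m → Ω → ℝ)
        (F₁ : ℕ → MvPolynomial (Fin m) ℝ) (F₂ : MvPolynomial (Fin (m + 1)) ℝ)
        (S : Fin m → Finset ℝ),
        3 ≤ H → RandomPoly.Model d k m L H C μ a t F₁ F₂ S →
        (RandomPoly.UniformOnValueSet μ (a 0) P H ∨ RandomPoly.UniformOnValueList μ (a 0) P H) →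
        1 - (P.natDegree : ℝ) / (2 * H + 1) -
            2 * C * m * d * 2 ^ d * L * Real.log H ^ K / H
          ≤ μ.real (RandomPoly.irredEvent d a)) ∧
    -- constant coefficient supported on `s`-simple integers
    (∀ (Ω : Type u) [MeasurableSpace Ω] (μ : Measure Ω) [IsProbabilityMeasure μ]
        (d k m L H : ℕ) (C s : ℝ) (a : ℕ → Ω → ℤ) (t : Fin m → Ω → ℝ)
        (F₁ : ℕ → MvPolynomial (Fin m) ℝ) (F₂ : MvPolynomial (Fin (m + 1)) ℝ)
        (S : Fin m → Finset ℝ),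
        1 ≤ H → RandomPoly.Model d k m L H C μ a t F₁ F₂ S →
        (∀ᵐ ω ∂μ, RandomPoly.IsSimple s (a 0 ω).natAbs) →
        1 - 2 * C * m * d * 2 ^ d * L * s / H ≤ μ.real (RandomPoly.irredEvent d a)) := by
  refine ⟨?_, ?_, ?_⟩
  · intro Ω _ μ _ d k m L H C a t F₁ F₂ S hH h
    rw [tsub_le_iff_right, tsub_le_iff_right]
    exact h.one_le_measure_irredEvent_add hH
  · intro P hP
    obtain ⟨K, hK⟩ := RandomPoly.exists_log_pow_bound hP
    refine ⟨K, fun Ω _ μ _ d k m L H C a t F₁ F₂ S hH h hdist => ?_⟩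
    have hN : (0 : ℝ) < 2 * H + 1 := by positivity
    have h0 := RandomPoly.measureReal_zero_le h.measurable_a hP hdist
    have hI := (RandomPoly.setLIntegral_tau_le h.measurable_a hdist).trans
      (ENNReal.ofReal_le_ofReal ((div_le_iff₀' hN).mpr (hK H hH)))
    have := h.le_real_irredEvent (by omega)
      (Real.rpow_nonneg (Real.log_natCast_nonneg H) K) hI
    linarith
  · intro Ω _ μ _ d k m L H C s a t F₁ F₂ S hH h hs
    have h0 : μ.real {ω | a 0 ω = 0} = 0 := by
      have h1 : ∀ᵐ ω ∂μ, ¬ a 0 ω = 0 := hs.mono fun ω hω => Int.natAbs_pos.mp hω.1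
      have h2 : μ {ω | a 0 ω = 0} = 0 := by simpa [MeasureTheory.ae_iff] using h1
      rw [measureReal_def, h2, ENNReal.toReal_zero]
    have hs0 : 0 ≤ s := by
      obtain ⟨ω, hω⟩ := hs.exists
      exact (Nat.cast_nonneg _).trans hω.2
    have := h.le_real_irredEvent hH hs0 (RandomPoly.setLIntegral_tau_le_of_isSimple hs)
    linarith
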